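/- Let $p\in(1,\infty]$, $q\in(1,p)$. Let $U=\mathbb R^m$ and $u_\star=0$ if $p<\infty$; let $U\subset\mathbb R^m$ be compact and convex and $u_\star\in U$ if $p=\infty$. Let $\mathcal U=L^p((0,\infty),U)$ with the weak$^\star$ topology $\sigma(L^p,L^{p'})$, and $\mathcal X=W^{1,1}_{\rm loc}([0,\infty),\mathbb R^n)$, identified with the locally absolutely continuous functions $[0,\infty)\to\mathbb R^n$. All ``a.e. $t$'' refer to $t>0$. State equation. Let $a:[0,\infty)\times\mathbb R^n\to\mathbb R^n$ and $b:[0,\infty)\times\mathbb R^n\to\mathbb R^{n\times m}$ be measurable in $t$ for each fixed $x$, and put $r=\frac{pq}{p-q}$ if $p<\infty$, $r=q$ if $p=\infty$. Assume that there are $M\in L^q_{\rm loc}([0,\infty))$, $N\in L^r_{\rm loc}([0,\infty))$ with $|a(t,0)|\le M(t)$, $|b(t,0)|\le N(t)$ for a.e. $t$, and that for every compact $H\subset\mathbb R^n$ there are $A_H\in L^q_{\rm loc}([0,\infty))$, $B_H\in L^r_{\rm loc}([0,\infty))$ with $|a(t,x_1)-a(t,x_2)|\le A_H(t)|x_1-x_2|$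 and $|b(t,x_1)-b(t,x_2)|\le B_H(t)|x_1-x_2|$ for a.e. $t$ and all $x_1,x_2\in H$. For $u\in\mathcal U$, $x_0\in\mathbb R^n$, let $x^{u,x_0}$ be the unique maximal locally absolutely continuous solution of $x'(t)=a(t,x(t))+b(t,x(t))u(t)$, $x(0)=x_0$. Cost. Let $\ell:(0,\infty)\times\mathbb R^n\times\mathbb R^m\to[0,\infty]$ be such that: (A) (dissipativity with coercive storage function) there is $S:\mathbb R^n\to[0,\infty)$ with bounded sublevel sets such that $S(x^{u,x_0}(t))-S(x_0)\le\int_0^t\ell(s,x^{u,x_0}(s),u(s))\,ds$ for all $u\in\mathcal U$, $x_0\in\mathbb R^n$, $t\in\operatorname{dom}(x^{u,x_0})$; (B) $\ell(t,x,u)=\ell_1(t,x)+\ell_2(t,x,u)$, where $\ell_1,\ell_2$ take values in $[0,\infty]$, are measurable with respect to the product of the Lebesgue $\sigma$-algebra in $t$ and the Borel $\sigma$-algebras in the other variables, $\ell_1(t,\cdot)$ and $\ell_2(t,\cdot,\cdot)$ are lower semicontinuous for a.e. $t$, and for a.e. $t$ the function $\ell_2(t,x,\cdot)$ is convex for all $x$;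 (C) for every compact $K\subset\mathbb R^n$ there is $m_K\in L^1(0,\infty)$ with $\ell_2(t,x,u_\star)\le m_K(t)$ for a.e. $t$ and all $x\in K$; moreover, if $p<\infty$, there are $\alpha>0$ and $\gamma\in L^1(0,\infty)$ with $\ell_2(t,x,u)\ge\alpha|u|^p-\gamma(t)$ for a.e. $t$ and all $x\in\mathbb R^n$, $u\in\mathbb R^m$. Problems. Fix $x_0\in\mathbb R^n$. For finite $T$ let $\mathcal A_T$ be the set of $(u,x)\in\mathcal U\times\mathcal X$ with $u=u_\star$ a.e. on $(T,\infty)$, $x=x^{u,x_0}$ on $[0,T]$ and $x(t)=x(T)e^{-(t-T)}$ for $t>T$; let $\mathcal A_\infty$ be the set of $(u,x)\in\mathcal U\times\mathcal X$ with $x=x^{u,x_0}$ on $[0,\infty)$. For $T\le\infty$ let $\mathcal F_T(u,x)=\int_0^T\ell(t,x(t),u(t))\,dt$ if $(u,x)\in\mathcal A_T$ and $\mathcal F_T(u,x)=+\infty$ otherwise. Theorem. For every $x_0\in\mathbb R^n$ and every sequence $0\le T_k\to\infty$, the family $(\mathcal F_T)$ is $(T_k)$-pattern preserving, that is: let $(u_k,x_k)\in\mathcal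 U\times\mathcal X$ be any sequence with $$\liminf_{k\to\infty}\mathcal F_{T_k}(u_k,x_k)=\liminf_{k\to\infty}\inf_{\mathcal U\times\mathcal X}\mathcal F_{T_k},$$ and suppose that for some $N\ge1$ independent of $k$, some $u^k_1,\dots,u^k_N\in\mathcal U$ and some $0=\tau^k_0\le\tau^k_1\le\dots\le\tau^k_N=T_k$ one has $u_k=\sum_{j=1}^Nu^k_j\mathbf 1_{[\tau^k_{j-1},\tau^k_j)}$ a.e. on $[0,T_k]$ and, as $k\to\infty$, $\tau^k_j\to\tau^\infty_j$ in $[-\infty,\infty]$ for $0\le j\le N$ and $u^k_j\to u^\infty_j$ in $\mathcal U$ for $1\le j\le N$. Then $$u_\infty:=\sum_{j=1}^Nu^\infty_j\mathbf 1_{[\tau^\infty_{j-1},\tau^\infty_j)}\qquad([\infty,\infty):=\varnothing)$$ belongs to $\mathcal U$ and is an optimal control for $\mathcal F_\infty$: there is $x\in\mathcal X$ with $\mathcal F_\infty(u_\infty,x)=\inf_{\mathcal U\times\mathcal X}\mathcal F_\infty$. -/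

import Mathlib

open MeasureTheory Filter Topology Set
open scoped ENNReal NNReal

noncomputable section

namespace OptCtrl

/-- `ℝⁿ`. -/
abbrev E (n : ℕ) : Type := EuclideanSpace ℝ (Fin n)

/-- Lebesgue measure on `(0, ∞)`. -/
def halfLine : Measure ℝ := volume.restrict (Ioi 0)

/-- `L^s_loc([0, ∞))`: `f` belongs to `L^s(0, R)` for every `R`. -/
def LpLoc (s : ℝ≥0∞) (f : ℝ → ℝ) : Prop :=
  ∀ R : ℝ, MemLp f s (volume.restrict (Icc 0 R))

/-! ### Control and state spaces -/

/-- The control space `L^p((0, ∞), U)`. -/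
structure Control (m : ℕ) (p : ℝ≥0∞) (U : Set (E m)) where
  toLp : Lp (E m) p halfLine
  mem_ae : ∀ᵐ t ∂halfLine, toLp t ∈ U

instance (m : ℕ) (p : ℝ≥0∞) (U : Set (E m)) : CoeFun (Control m p U) (fun _ => ℝ → E m) :=
  ⟨fun u => u.toLp⟩

/-- The weak-star topology `σ(L^p, L^{p'})` on the control space: the coarsest topology for which
`u ↦ ∫ ⟨g, u⟩` is continuous for every `g ∈ L^{p'}((0, ∞), ℝᵐ)`. -/
instance (m : ℕ) (p : ℝ≥0∞) (U : Set (E m)) : TopologicalSpace (Control m p U) :=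
  TopologicalSpace.induced
    (fun (u : Control m p U) (g : Lp (E m) p.conjExponent halfLine) =>
      ∫ t, inner ℝ (g t) (u t) ∂halfLine)
    Pi.topologicalSpace

/-- The state space `W^{1,1}_loc([0, ∞), ℝⁿ)`: locally absolutely continuous functions on
`[0, ∞)`. Only the values on `[0, ∞)` are ever used. -/
structure State (n : ℕ) where
  toFun : ℝ → E n
  locAC : ∀ R : ℝ, 0 ≤ R → AbsolutelyContinuousOnInterval toFun 0 R

instance (n : ℕ) : CoeFun (State n) (fun _ => ℝ → E n) := ⟨State.toFun⟩

/-! ### Families of optimal control problems, minimizing sequences, pattern preservation -/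

/-- `u` is an optimal control for the joint functional `F`. -/
def IsOptimalControl {𝒰 𝒳 : Type*} (F : 𝒰 × 𝒳 → EReal) (u : 𝒰) : Prop :=
  ∃ x : 𝒳, F (u, x) = ⨅ z, F z

/-- `z k = (u_k, x_k)` is a minimizing sequence for the sequence of functionals `F k`. -/
def IsMinimizingSeq {Z : Type*} (F : ℕ → Z → EReal) (z : ℕ → Z) : Prop :=
  liminf (fun k => F k (z k)) atTop = liminf (fun k => ⨅ w, F k w) atTop

/-- The piecewise function `∑ⱼ vⱼ 𝟏_{[τⱼ₋₁, τⱼ)}`, with endpoints in the extended reals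
(so that `[∞, ∞) = ∅`). -/
def piecewise {m N : ℕ} (v : Fin N → ℝ → E m) (τ : Fin (N + 1) → EReal) (t : ℝ) : E m :=
  ∑ j : Fin N, {s : ℝ | τ j.castSucc ≤ (s : EReal) ∧ (s : EReal) < τ j.succ}.indicator (v j) t

/-- The family `F T`, `T ∈ (0, ∞]`, is `(T_k)`-pattern preserving. -/
def PatternPreserving {m : ℕ} {p : ℝ≥0∞} {U : Set (E m)} {𝒳 : Type*}
    (F : EReal → Control m p U × 𝒳 → EReal) (T : ℕ → ℝ) : Prop :=
  ∀ (u : ℕ → Control m p U) (x : ℕ → 𝒳),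
    IsMinimizingSeq (fun k => F (T k)) (fun k => (u k, x k)) →
    ∀ (N : ℕ), 0 < N →
    ∀ (v : ℕ → Fin N → Control m p U) (τ : ℕ → Fin (N + 1) → ℝ)
      (vLim : Fin N → Control m p U) (τLim : Fin (N + 1) → EReal),
      (∀ k, Monotone (τ k) ∧ τ k 0 = 0 ∧ τ k (Fin.last N) = T k) →
      (∀ k, ∀ᵐ t ∂halfLine, t ≤ T k →
        u k t = piecewise (fun j => v k j) (fun j => (τ k j : EReal)) t) →
      (∀ j, Tendsto (fun k => (τ k j : EReal)) atTop (𝓝 (τLim j))) →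
      (∀ j, Tendsto (fun k => v k j) atTop (𝓝 (vLim j))) →
      ∃ uLim : Control m p U,
        (∀ᵐ t ∂halfLine, uLim t = piecewise (fun j => vLim j) τLim t) ∧
        IsOptimalControl (F ⊤) uLim

/-! ### The state equation -/

/-- `x` is an absolutely continuous (Carathéodory) solution on `[0, τ]` of
`x' = a(t, x) + b(t, x) u(t)`, `x(0) = x₀`. -/
def IsSolutionOn {n m : ℕ} (a : ℝ → E n → E n) (b : ℝ → E n → E m →L[ℝ] E n)
    (u : ℝ → E m) (x₀ : E n) (τ : ℝ) (x : ℝ → E n) : Prop :=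
  x 0 = x₀ ∧ AbsolutelyContinuousOnInterval x 0 τ ∧
    ∀ᵐ t ∂(volume.restrict (Ioo 0 τ)), HasDerivAt x (a t (x t) + b t (x t) (u t)) t

/-- Carathéodory–Lipschitz conditions on `a` and `b`, with bounds on `a` in `L^s_loc([0, ∞))` and
bounds on `b` in `L^r_loc([0, ∞))`. -/
structure CaratheodoryLipschitz {n m : ℕ} (a : ℝ → E n → E n)
    (b : ℝ → E n → E m →L[ℝ] E n) (s r : ℝ≥0∞) : Prop where
  meas_a : ∀ x, AEStronglyMeasurable (fun t => a t x) halfLine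
  meas_b : ∀ x, AEStronglyMeasurable (fun t => b t x) halfLine
  bound_a : ∃ M : ℝ → ℝ, LpLoc s M ∧ ∀ᵐ t ∂halfLine, ‖a t 0‖ ≤ M t
  lip_a : ∀ H : Set (E n), IsCompact H → ∃ A : ℝ → ℝ, LpLoc s A ∧
    ∀ᵐ t ∂halfLine, ∀ x₁ ∈ H, ∀ x₂ ∈ H, ‖a t x₁ - a t x₂‖ ≤ A t * ‖x₁ - x₂‖
  bound_b : ∃ N : ℝ → ℝ, LpLoc r N ∧ ∀ᵐ t ∂halfLine, ‖b t 0‖ ≤ N t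
  lip_b : ∀ H : Set (E n), IsCompact H → ∃ B : ℝ → ℝ, LpLoc r B ∧
    ∀ᵐ t ∂halfLine, ∀ x₁ ∈ H, ∀ x₂ ∈ H, ‖b t x₁ - b t x₂‖ ≤ B t * ‖x₁ - x₂‖

/-- The exponent `pq/(p-q)`, read as `q` when `p = ∞`. -/
def gapExponent (p q : ℝ≥0∞) : ℝ≥0∞ := if p = ∞ then q else p * q / (p - q)

/-! ### Integrands -/

/-- A nonnegative normal integrand on `(0, ∞) × X`: measurable for the product of the Lebesgue
σ-algebra on `(0, ∞)` and the σ-algebra of `X`, and lower semicontinuous in the second variable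
for a.e. `t`. Extending a function by `0` from `(0, ∞) × X` to `ℝ × X` does not affect its
measurability. -/
structure IsNormalIntegrand {X : Type*} [TopologicalSpace X] [MeasurableSpace X]
    (f : ℝ → X → ℝ≥0∞) : Prop where
  meas : Measurable (fun z : NullMeasurableSpace ℝ volume × X =>
    (Ioi (0 : ℝ)).indicator (fun t => f t z.2) z.1)
  lsc : ∀ᵐ t ∂halfLine, LowerSemicontinuous (f t)

/-- A nonnegative normal convex integrand on `(0, ∞) × ℝⁿ × ℝᵐ`, convex in the last variable. -/
structure IsNormalConvexIntegrand {n m : ℕ} (f : ℝ → E n → E m → ℝ≥0∞) : Prop where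
  normal : IsNormalIntegrand (fun t (z : E n × E m) => f t z.1 z.2)
  convex : ∀ᵐ t ∂halfLine, ∀ x, ConvexOn ℝ≥0 univ (f t x)

/-! ### Dissipativity -/

/-- `S` is a storage function witnessing that the state equation is dissipative with respect to
the nonnegative supply function `r`, for controls in `L^p((0, ∞), U)`. A time `t ≥ 0` lies in the
domain of the maximal solution exactly when there is a solution `x` on `[0, t]`, and `x` is then
the restriction of the maximal solution. -/
def IsStorageFunction {n m : ℕ} (p : ℝ≥0∞) (U : Set (E m)) (a : ℝ → E n → E n)
    (b : ℝ → E n → E m →L[ℝ] E n) (r : ℝ → E n → E m → ℝ≥0∞) (S : E n → ℝ) : Prop :=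
  (∀ x, 0 ≤ S x) ∧
  ∀ (u : Control m p U) (x₀ : E n) (t : ℝ) (x : ℝ → E n), 0 ≤ t → IsSolutionOn a b u x₀ t x →
    ((S (x t) - S x₀ : ℝ) : EReal) ≤ ((∫⁻ s in Ioo 0 t, r s (x s) (u s) : ℝ≥0∞) : EReal)

/-- Coercivity: all sublevel sets are bounded. -/
def IsCoercive {n : ℕ} (G : E n → ℝ) : Prop :=
  ∀ c : ℝ, Bornology.IsBounded {x | G x ≤ c}

/-! ### The optimal control problems -/

section Problem

variable {n m : ℕ} {p : ℝ≥0∞} {U : Set (E m)}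

/-- The admissible set `A_T` for a finite horizon `T`. -/
def admissibleFin (a : ℝ → E n → E n) (b : ℝ → E n → E m →L[ℝ] E n) (uStar : E m) (x₀ : E n)
    (T : ℝ) : Set (Control m p U × State n) :=
  {z | (∀ᵐ t ∂halfLine, T < t → z.1 t = uStar) ∧ IsSolutionOn a b z.1 x₀ T z.2 ∧
    ∀ t, T < t → z.2 t = Real.exp (-(t - T)) • z.2 T}

/-- The admissible set `A_∞`. -/
def admissibleInf (a : ℝ → E n → E n) (b : ℝ → E n → E m →L[ℝ] E n) (x₀ : E n) :
    Set (Control m p U × State n) :=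
  {z | ∀ T : ℝ, 0 ≤ T → IsSolutionOn a b z.1 x₀ T z.2}

/-- The admissible set `A_T`, with `T = ⊤` for the infinite horizon. -/
def admissible (a : ℝ → E n → E n) (b : ℝ → E n → E m →L[ℝ] E n) (uStar : E m) (x₀ : E n)
    (T : EReal) : Set (Control m p U × State n) :=
  {z | (T = ⊤ → z ∈ admissibleInf a b x₀) ∧ (T ≠ ⊤ → z ∈ admissibleFin a b uStar x₀ T.toReal)}

/-- The cost `J_T(u, x) = ∫₀ᵀ ℓ(t, x(t), u(t)) dt`. -/
def cost (ℓ : ℝ → E n → E m → ℝ≥0∞) (T : EReal) (z : Control m p U × State n) : ℝ≥0∞ :=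
  ∫⁻ t in {t : ℝ | 0 < t ∧ (t : EReal) < T}, ℓ t (z.2 t) (z.1 t)

open Classical in
/-- The joint functional `F_T = J_T + χ_{A_T}`. -/
def jointFunctional (a : ℝ → E n → E n) (b : ℝ → E n → E m →L[ℝ] E n) (uStar : E m)
    (ℓ : ℝ → E n → E m → ℝ≥0∞) (x₀ : E n) (T : EReal) (z : Control m p U × State n) : EReal :=
  (cost ℓ T z : EReal) + (if z ∈ admissible a b uStar x₀ T then 0 else ⊤)

end Problem

end OptCtrl

end

/-! The proof is the direct method, applied to horizons that grow. Two facts suffice. The upper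
bound: cutting an infinite-horizon competitor off at time `T k` gives a competitor for that horizon
at no larger cost, because the running cost is nonnegative (`exists_truncation`). Hence the liminf
of the finite-horizon values is at most the infinite-horizon value. The lower bound: `uLim` has a
trajectory whose infinite-horizon cost is at most the liminf of the costs of the minimizing
sequence. `isOptimalControl_of_isMinimizingSeq` combines the two.

For the lower bound, the given controls need not converge weak-star on the half line, but they do
converge weakly on every bounded interval (`tendsto_integral_of_piecewise`). Multiplying a piece by
the indicator of its cell amounts to multiplying the test function by it. The cut-off test functions
converge strongly in the dual space, whose exponent is finite because `1 < p`, so they can be paired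
with weak-star convergent pieces.

Along a subsequence of bounded cost, dissipativity and coercivity of the storage function confine
all trajectories to one ball. Coercivity of the cost, or boundedness of `U`, bounds the controls in
L^p. Hölder's inequality then makes the trajectories equicontinuous on compact intervals, and a
subsequence converges pointwise. The dynamics are affine in the control, so strong convergence of
`b(·, x_k)` times weak convergence of `u_k` passes to the limit in the integral equation
(`RegularSystem.exists_limit_trajectory`).

Finally, the cost on each bounded interval is lower semicontinuous for pointwise convergence of
states and weak convergence of controls (`lintegral_le_of_tendsto_of_weak_tendsto`). Mazur's lemma
turns weak convergence into almost everywhere convergence of convex combinations. A separation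
argument, with superlinear growth supplying compactness, absorbs the fact that the combined
integrands are evaluated at different states; Fatou's lemma concludes. Letting the interval grow
gives the bound on the half line. -/

namespace OptCtrl

/-! ### Duality for L¹ and Mazur's lemma -/

section Analysis

variable {α : Type*} [MeasurableSpace α] {μ : Measure α}

/-- Dominated convergence to zero in `L^s`, `s < ∞`. -/
theorem tendsto_eLpNorm_zero_of_dominated {F : Type*} [NormedAddCommGroup F] {φ : ℕ → α → F}
    {Φ : α → ℝ} {s : ℝ≥0∞} (hs : s ≠ 0) (hs' : s ≠ ∞)
    (hφ : ∀ᶠ k in atTop, AEStronglyMeasurable (φ k) μ) (hΦ : MemLp Φ s μ)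
    (hb : ∀ᶠ k in atTop, ∀ᵐ x ∂μ, ‖φ k x‖ ≤ Φ x)
    (hl : ∀ᵐ x ∂μ, Tendsto (fun k => φ k x) atTop (𝓝 0)) :
    Tendsto (fun k => eLpNorm (φ k) s μ) atTop (𝓝 0) := by
  have hpos : 0 < s.toReal := ENNReal.toReal_pos hs hs'
  simp_rw [eLpNorm_eq_lintegral_rpow_enorm_toReal hs hs']
  have key : Tendsto (fun k => ∫⁻ x, ‖φ k x‖ₑ ^ s.toReal ∂μ) atTop (𝓝 (∫⁻ _, 0 ∂μ)) := by
    refine tendsto_lintegral_filter_of_dominated_convergence' (fun x => ‖Φ x‖ₑ ^ s.toReal) ?_ ?_ ?_ ?_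
    · filter_upwards [hφ] with k hk
      exact hk.enorm.pow_const _
    · filter_upwards [hb] with k hk
      filter_upwards [hk] with x hx
      gcongr
      exact enorm_le_iff_norm_le.2 (hx.trans (le_abs_self _))
    · exact (lintegral_rpow_enorm_lt_top_of_eLpNorm_lt_top hs hs' hΦ.2).ne
    · filter_upwards [hl] with x hx
      have := (ENNReal.continuous_rpow_const (y := s.toReal)).tendsto 0 |>.comp
        (by simpa using hx.enorm : Tendsto (fun k => ‖φ k x‖ₑ) atTop (𝓝 0))
      simpa [hpos, Function.comp_def] using this
  simp only [lintegral_zero] at key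
  have := (ENNReal.continuous_rpow_const (y := 1 / s.toReal)).tendsto 0 |>.comp key
  simpa [hpos, Function.comp_def] using this

variable {F : Type*} [NormedAddCommGroup F] [InnerProductSpace ℝ F] [CompleteSpace F]

/-- Continuous linear functionals on `L¹` of a finite measure, with values in a Hilbert space, are
represented by bounded functions. -/
theorem exists_bounded_representation [IsFiniteMeasure μ] (φ : Lp F 1 μ →L[ℝ] ℝ) :
    ∃ g : α → F, AEStronglyMeasurable g μ ∧ (∀ᵐ x ∂μ, ‖g x‖ ≤ ‖φ‖) ∧
      ∀ v : Lp F 1 μ, φ v = ∫ x, inner ℝ (g x) (v x) ∂μ := by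
  -- For a finite measure L² embeds in L¹: the inclusion is Hölder multiplication by the constant 1
  -- in L². Restricting `φ` along it lets the Riesz theorem in L² produce the density `g`.
  have h1 : MemLp (fun _ : α => (1 : ℝ)) 2 μ := memLp_const 1
  let ι : Lp F 2 μ →L[ℝ] Lp F 1 μ :=
    (ContinuousLinearMap.lsmul ℝ ℝ).holderL μ 2 2 1 h1.toLp
  have hι : ∀ v : Lp F 2 μ, ι v =ᵐ[μ] v := by
    intro v
    have h := ContinuousLinearMap.coeFn_holder (r := 1) (ContinuousLinearMap.lsmul ℝ ℝ)
      (h1.toLp) v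
    filter_upwards [h, h1.coeFn_toLp] with x hx hx1
    have : ι v = ContinuousLinearMap.holder 1 (ContinuousLinearMap.lsmul ℝ ℝ) h1.toLp v := rfl
    rw [this, hx, hx1]
    simp
  let g : Lp F 2 μ := (InnerProductSpace.toDual ℝ (Lp F 2 μ)).symm (φ.comp ι)
  have hg : ∀ v : Lp F 2 μ, φ (ι v) = ∫ x, inner ℝ (g x) (v x) ∂μ := by
    intro v
    rw [← L2.inner_def, InnerProductSpace.toDual_symm_apply]
    rfl
  have hgm : AEStronglyMeasurable g μ := (Lp.memLp g).1
  have hgi : Integrable (fun x => ‖g x‖) μ :=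
    ((Lp.memLp g).integrable (by norm_num)).norm
  have hbound : ∀ᵐ x ∂μ, ‖g x‖ ≤ ‖φ‖ := by
    refine ae_le_of_forall_setIntegral_le hgi (integrable_const _) fun A hA _ => ?_
    -- Testing with the unit field `g / ‖g‖` on `A` gives `∫_A ‖g‖ ≤ ‖φ‖ μ(A)` for every `A`, hence
    -- the pointwise bound.
    let w : α → F := A.indicator fun x => ‖g x‖⁻¹ • g x
    have hw_norm : ∀ x, ‖w x‖ ≤ A.indicator (fun _ => (1 : ℝ)) x := by
      intro x
      by_cases hx : x ∈ A
      · simp only [w, indicator_of_mem hx, norm_smul, norm_inv, norm_norm]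
        exact inv_mul_le_one
      · simp [w, hx]
    have hwm : AEStronglyMeasurable w μ :=
      (hgm.norm.inv₀.smul hgm).indicator hA
    have hw2 : MemLp w 2 μ := MemLp.of_bound hwm 1 (ae_of_all _ fun x => (hw_norm x).trans
      (indicator_le_self' (fun _ _ => zero_le_one) x))
    have h2 : φ (ι hw2.toLp) = ∫ x in A, ‖g x‖ ∂μ := by
      rw [hg, ← integral_indicator hA]
      refine integral_congr_ae ?_
      filter_upwards [hw2.coeFn_toLp] with x hx
      rw [hx]
      by_cases hxA : x ∈ A
      · simp only [w, indicator_of_mem hxA, inner_smul_right, real_inner_self_eq_norm_sq]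
        by_cases h0 : ‖g x‖ = 0
        · simp [h0]
        · field_simp
      · simp [w, hxA]
    rw [← h2]
    refine (le_abs_self _).trans ((φ.le_opNorm _).trans ?_)
    rw [setIntegral_const, smul_eq_mul, mul_comm]
    gcongr
    rw [L1.norm_eq_integral_norm]
    have : ∫ x, ‖ι hw2.toLp x‖ ∂μ = ∫ x, ‖w x‖ ∂μ := by
      refine integral_congr_ae ?_
      filter_upwards [hι hw2.toLp, hw2.coeFn_toLp] with x hx hx2
      rw [hx, hx2]
    rw [this]
    calc ∫ x, ‖w x‖ ∂μ ≤ ∫ x, A.indicator (fun _ => (1 : ℝ)) x ∂μ := by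
          refine integral_mono_of_nonneg (ae_of_all _ fun _ => norm_nonneg _)
            ((integrable_const _).indicator hA) (ae_of_all _ hw_norm)
      _ = μ.real A := by rw [integral_indicator hA]; simp
  refine ⟨g, hgm, hbound, ?_⟩
  have hgtop : MemLp g ∞ μ := memLp_top_of_bound hgm _ hbound
  have hpair : ∀ v : Lp F 1 μ, (innerSL ℝ).lpPairing μ ∞ 1 hgtop.toLp v =
      ∫ x, inner ℝ (g x) (v x) ∂μ := by
    intro v
    rw [ContinuousLinearMap.lpPairing_eq_integral]
    refine integral_congr_ae ?_
    filter_upwards [hgtop.coeFn_toLp] with x hx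
    rw [hx]; rfl
  suffices h : ∀ v : Lp F 1 μ, φ v = (innerSL ℝ).lpPairing μ ∞ 1 hgtop.toLp v by
    intro v; rw [h, hpair]
  intro v
  -- Both sides are continuous on L¹, so agreement on indicators suffices; these lie in L², where
  -- the Riesz formula applies.
  induction v using Lp.induction (by norm_num : (1 : ℝ≥0∞) ≠ ∞) with
  | indicatorConst c hs hμs =>
    rename_i s
    rw [hpair, Lp.simpleFunc.coe_indicatorConst]
    have h2 : ι (indicatorConstLp 2 hs hμs.ne c) = indicatorConstLp 1 hs hμs.ne c := by
      refine Lp.ext ?_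
      filter_upwards [hι (indicatorConstLp 2 hs hμs.ne c),
        indicatorConstLp_coeFn (p := 2) (hs := hs) (hμs := hμs.ne) (c := c),
        indicatorConstLp_coeFn (p := 1) (hs := hs) (hμs := hμs.ne) (c := c)] with x h1 h2 h3
      rw [h1, h2, h3]
    rw [← h2, hg]
    refine integral_congr_ae ?_
    filter_upwards [hι (indicatorConstLp 2 hs hμs.ne c)] with x hx
    rw [hx]
  | add hf hg' hdisj hf1 hg1 => rw [map_add, map_add, hf1, hg1]
  | isClosed => exact isClosed_eq φ.continuous (ContinuousLinearMap.continuous _)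

/-- Mazur's lemma in `L¹` of a finite measure. -/
theorem exists_convexCombination_tendsto [IsFiniteMeasure μ] {f : ℕ → α → F} {f₀ : α → F}
    (hf : ∀ k, Integrable (f k) μ) (hf₀ : Integrable f₀ μ)
    (hlim : ∀ g : α → F, AEStronglyMeasurable g μ → (∃ C, ∀ᵐ x ∂μ, ‖g x‖ ≤ C) →
      Tendsto (fun k => ∫ x, inner ℝ (g x) (f k x) ∂μ) atTop (𝓝 (∫ x, inner ℝ (g x) (f₀ x) ∂μ)))
    (K : ℕ) {ε : ℝ} (hε : 0 < ε) :
    ∃ (ι : Type) (_ : Fintype ι) (w : ι → ℝ) (z : ι → ℕ), (∀ i, K ≤ z i) ∧ (∀ i, 0 ≤ w i) ∧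
      ∑ i, w i = 1 ∧
      eLpNorm ((fun x => ∑ i, w i • f (z i) x) - f₀) 1 μ ≤ ENNReal.ofReal ε := by
  let a : ℕ → Lp F 1 μ := fun k => (hf k).toL1
  let a₀ : Lp F 1 μ := hf₀.toL1
  -- Otherwise Hahn–Banach separates `a₀` strictly from the closed convex hull of the tail, and the
  -- representation of the functional by a bounded `g` contradicts `hlim`.
  have hmem : a₀ ∈ closure (convexHull ℝ (a '' Ici K)) := by
    by_contra hn
    obtain ⟨φ, s, hs1, hs2⟩ := geometric_hahn_banach_point_closed
      (convex_convexHull ℝ (a '' Ici K)).closure isClosed_closure hn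
    obtain ⟨g, hgm, hgb, hg⟩ := exists_bounded_representation φ
    have h1 : ∀ v (hv : Integrable v μ), φ hv.toL1 = ∫ x, inner ℝ (g x) (v x) ∂μ := by
      intro v hv
      rw [hg]
      refine integral_congr_ae ?_
      filter_upwards [hv.coeFn_toL1] with x hx
      rw [hx]
    have h2 : Tendsto (fun k => φ (a k)) atTop (𝓝 (φ a₀)) := by
      simp only [a, a₀, h1]
      exact hlim g hgm ⟨_, hgb⟩
    have h3 : s ≤ φ a₀ := ge_of_tendsto h2 <| by
      filter_upwards [eventually_ge_atTop K] with k hk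
      exact (hs2 _ (subset_closure (subset_convexHull ℝ _ ⟨k, hk, rfl⟩))).le
    exact absurd hs1 (not_lt.2 h3)
  obtain ⟨c, hc, hdist⟩ := Metric.mem_closure_iff.1 hmem ε hε
  obtain ⟨ι, hι, w, y, hw0, hw1, hy, hyc⟩ := mem_convexHull_iff_exists_fintype.1 hc
  choose z hz hzy using hy
  refine ⟨ι, hι, w, z, hz, hw0, hw1, ?_⟩
  have hc' : c =ᵐ[μ] fun x => ∑ i, w i • f (z i) x := by
    rw [← hyc]
    have h1 : ∀ᵐ x ∂μ, ∀ i : ι, a (z i) x = f (z i) x :=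
      ae_all_iff.2 fun i => (hf (z i)).coeFn_toL1
    have h2 : ∀ᵐ x ∂μ, ∀ i : ι, (w i • y i : Lp F 1 μ) x = w i • (y i : Lp F 1 μ) x :=
      ae_all_iff.2 fun i => Lp.coeFn_smul (w i) (y i)
    filter_upwards [h1, h2, Lp.coeFn_fun_finsetSum Finset.univ (fun i => w i • y i)]
      with x hx1 hx2 hx3
    rw [hx3]
    refine Finset.sum_congr rfl fun i _ => ?_
    rw [hx2, ← hzy, hx1]
  have h4 : eLpNorm ((fun x => ∑ i, w i • f (z i) x) - f₀) 1 μ = eLpNorm (⇑(c - a₀)) 1 μ := by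
    refine eLpNorm_congr_ae ?_
    filter_upwards [hc', hf₀.coeFn_toL1, Lp.coeFn_sub c a₀] with x h1 h2 h3
    rw [h3, Pi.sub_apply, Pi.sub_apply, h1, h2]
  rw [h4, ← Lp.enorm_def, ← ofReal_norm, ← dist_eq_norm, dist_comm]
  exact ENNReal.ofReal_le_ofReal hdist.le

end Analysis

/-! ### Pointwise lower semicontinuity under convex combinations -/

section LowerSemicontinuity

variable {X F : Type*} [TopologicalSpace X] [NormedAddCommGroup F] [NormedSpace ℝ F]

/-- Superlinear growth of `f (y, ·)` on `U`, uniformly in `y`. -/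
def UniformlySuperlinear (f : X → F → ℝ≥0∞) (U : Set F) : Prop :=
  ∀ c : ℝ, ∃ ρ : ℝ, ∀ y, ∀ v ∈ U, ∀ r : ℝ, r ≤ c * (1 + ‖v‖) → f y v ≤ ENNReal.ofReal r → ‖v‖ ≤ ρ

/-- A convex combination of points in the epigraph of a convex function stays in the epigraph. -/
theorem convex_real_epigraph {f : F → ℝ≥0∞} {U : Set F} (hU : Convex ℝ U)
    (hf : ConvexOn ℝ≥0 univ f) :
    Convex ℝ {z : F × ℝ | z.1 ∈ U ∧ 0 ≤ z.2 ∧ f z.1 ≤ ENNReal.ofReal z.2} := by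
  rintro ⟨v, r⟩ ⟨hv, hr, hvr⟩ ⟨w, s⟩ ⟨hw, hs, hws⟩ a b ha hb hab
  refine ⟨hU hv hw ha hb hab, ?_, ?_⟩
  · exact add_nonneg (mul_nonneg ha hr) (mul_nonneg hb hs)
  · lift a to ℝ≥0 using ha
    lift b to ℝ≥0 using hb
    have h := hf.2 (mem_univ v) (mem_univ w) zero_le zero_le (by exact_mod_cast hab)
    have e : ∀ (a : ℝ≥0) (r : ℝ), (a • ENNReal.ofReal r : ℝ≥0∞) = ENNReal.ofReal (a * r) := by
      intro a r
      rw [ENNReal.ofReal_mul a.coe_nonneg, ENNReal.smul_def, smul_eq_mul, ENNReal.ofReal_coe_nnreal]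
    calc f (a • v + b • w) ≤ a • f v + b • f w := h
      _ ≤ a • ENNReal.ofReal r + b • ENNReal.ofReal s := by gcongr
      _ = ENNReal.ofReal (a * r + b * s) := by
        rw [ENNReal.ofReal_add (by positivity) (by positivity), e, e]

/-- If `f (x, ·)` is convex, `f` is jointly lower semicontinuous and uniformly superlinear, then
limits of convex combinations of points in the epigraphs of `f (xᵢ, ·)`, `xᵢ → x`, belong to the
epigraph of `f (x, ·)`. -/
theorem le_of_convexCombinations_tendsto [FiniteDimensional ℝ F] {f : X → F → ℝ≥0∞} {U : Set F}
    (hU : Convex ℝ U) (hUc : IsClosed U)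
    (hlsc : LowerSemicontinuous (fun z : X × F => f z.1 z.2)) (hsup : UniformlySuperlinear f U)
    {x : ℕ → X} {x₀ : X} (hx : Tendsto x atTop (𝓝 x₀)) (hconv : ConvexOn ℝ≥0 univ (f x₀))
    {u : ℕ → F} (hu : ∀ i, u i ∈ U) {g : ℕ → ℝ} (hg : ∀ i, 0 ≤ g i)
    (hfg : ∀ i, f (x i) (u i) ≤ ENNReal.ofReal (g i))
    {ι : ℕ → Type} [∀ k, Fintype (ι k)] {w : ∀ k, ι k → ℝ} {z : ∀ k, ι k → ℕ}
    (hw : ∀ k i, 0 ≤ w k i) (hw1 : ∀ k, ∑ i, w k i = 1) (hz : ∀ k i, k ≤ z k i)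
    {u₀ : F}
    (hlim : Tendsto (fun k => ∑ i, w k i • u (z k i)) atTop (𝓝 u₀)) {s : ℝ} (hs : 0 ≤ s)
    (hfreq : ∃ᶠ k in atTop, ∑ i, w k i * g (z k i) ≤ s) :
    f x₀ u₀ ≤ ENNReal.ofReal s := by
  by_contra hlt
  set C : Set (F × ℝ) := {z | z.1 ∈ U ∧ 0 ≤ z.2 ∧ f x₀ z.1 ≤ ENNReal.ofReal z.2} with hC
  have hCconv : Convex ℝ C := convex_real_epigraph hU hconv
  have hepi := hlsc.isClosed_epigraph
  have hCclosed : IsClosed C := by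
    refine (hUc.preimage continuous_fst).inter ((isClosed_le continuous_const continuous_snd).inter ?_)
    exact hepi.preimage (f := fun z : F × ℝ => ((x₀, z.1), ENNReal.ofReal z.2))
      ((continuous_const.prodMk continuous_fst).prodMk (ENNReal.continuous_ofReal.comp continuous_snd))
  have hnot : (u₀, s) ∉ C := fun h => hlt h.2.2
  -- a separating functional with positive last coordinate
  obtain ⟨φ, d, A, hd, hA1, hA2⟩ : ∃ (φ : F →L[ℝ] ℝ) (d A : ℝ), 0 < d ∧ φ u₀ + d * s < A ∧
      ∀ v r, (v, r) ∈ C → A < φ v + d * r := by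
    obtain ⟨ψ, A, hA1, hA2⟩ := geometric_hahn_banach_point_closed hCconv hCclosed hnot
    have hψ : ∀ v r, ψ (v, r) = ψ (v, 0) + r * ψ (0, 1) := by
      intro v r
      have : (v, r) = (v, (0 : ℝ)) + r • ((0 : F), (1 : ℝ)) := by simp
      rw [this, map_add, map_smul, smul_eq_mul]
    rcases C.eq_empty_or_nonempty with he | ⟨⟨v₁, r₁⟩, h₁⟩
    · exact ⟨0, 1, s + 1, one_pos, by simp, fun v r h => by simp [he] at h⟩
    have hd0 : 0 ≤ ψ (0, 1) := by
      by_contra hneg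
      push Not at hneg
      obtain ⟨t, ht⟩ := exists_nat_gt ((A - ψ (v₁, r₁)) / ψ (0, 1))
      have hmem : (v₁, r₁ + t) ∈ C := by
        refine ⟨h₁.1, add_nonneg h₁.2.1 (Nat.cast_nonneg t), h₁.2.2.trans ?_⟩
        exact ENNReal.ofReal_le_ofReal (by simp)
      have h2 := hA2 _ hmem
      rw [hψ] at h2
      rw [div_lt_iff_of_neg hneg, hψ v₁ r₁] at ht
      nlinarith
    -- The separating hyperplane may be vertical. Tilting it by a small `δ` keeps `(u₀, s)` strictly
    -- below, and keeps `C` above because second coordinates in `C` are nonnegative. Dividing the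
    -- gap by `s + 1` also covers `s = 0`.
    obtain ⟨δ, hδ, hδs⟩ : ∃ δ > 0, ψ (u₀, s) + δ * s < A := by
      refine ⟨(A - ψ (u₀, s)) / (s + 1), div_pos (by linarith) (by linarith), ?_⟩
      have h3 : (A - ψ (u₀, s)) / (s + 1) * s < A - ψ (u₀, s) := by
        rw [div_mul_eq_mul_div, div_lt_iff₀ (by linarith)]
        nlinarith
      linarith
    refine ⟨ψ.comp (ContinuousLinearMap.inl ℝ F ℝ), ψ (0, 1) + δ, A, by linarith, ?_, ?_⟩
    · rw [hψ] at hδs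
      simp only [ContinuousLinearMap.comp_apply, ContinuousLinearMap.inl_apply]
      linarith
    · intro v r h
      have h2 := hA2 _ h
      rw [hψ] at h2
      simp only [ContinuousLinearMap.comp_apply, ContinuousLinearMap.inl_apply]
      have : 0 ≤ δ * r := mul_nonneg hδ.le h.2.1
      linarith
  -- the half space eventually contains the epigraphs
  have hev : ∀ᶠ i in atTop, A ≤ φ (u i) + d * g i := by
    by_contra hne
    rw [not_eventually] at hne
    obtain ⟨σ, hσ, hσA⟩ := extraction_of_frequently_atTop hne
    push Not at hσA
    -- A point below the hyperplane satisfies `d g < A + ‖φ‖ ‖u‖ ≤ (|A| + ‖φ‖)(1 + ‖u‖)`, so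
    -- superlinear growth bounds `u` and then `g`. A cluster point of such pairs lies in `C` by
    -- joint lower semicontinuity, yet on the wrong side.
    obtain ⟨ρ, hρ⟩ := hsup ((|A| + ‖φ‖) / d)
    have hgb : ∀ j, g (σ j) ≤ (|A| + ‖φ‖) / d * (1 + ‖u (σ j)‖) := by
      intro j
      have h1 := hσA j
      have h2 : -(‖φ‖ * ‖u (σ j)‖) ≤ φ (u (σ j)) := by
        have := φ.le_opNorm (u (σ j))
        rw [Real.norm_eq_abs] at this
        linarith [neg_abs_le (φ (u (σ j)))]
      rw [div_mul_eq_mul_div, le_div_iff₀ hd]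
      nlinarith [le_abs_self A, abs_nonneg A, norm_nonneg φ, norm_nonneg (u (σ j)),
        mul_nonneg (abs_nonneg A) (norm_nonneg (u (σ j)))]
    have hub : ∀ j, ‖u (σ j)‖ ≤ ρ := fun j => hρ _ _ (hu _) _ (hgb j) (hfg _)
    have hcpt : IsCompact (Metric.closedBall (0 : F) ρ ×ˢ Icc 0 ((|A| + ‖φ‖) / d * (1 + ρ))) :=
      (isCompact_closedBall 0 ρ).prod isCompact_Icc
    obtain ⟨⟨v, r⟩, -, τ, hτ, hlimτ⟩ := hcpt.tendsto_subseq
      (x := fun j => (u (σ j), g (σ j))) (fun j => by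
        refine ⟨by simpa using hub j, hg _, (hgb j).trans ?_⟩
        have : 0 ≤ (|A| + ‖φ‖) / d := by positivity
        gcongr
        exact hub j)
    have hlim1 : Tendsto (fun j => u (σ (τ j))) atTop (𝓝 v) :=
      (continuous_fst.tendsto _).comp hlimτ
    have hlim2 : Tendsto (fun j => g (σ (τ j))) atTop (𝓝 r) :=
      (continuous_snd.tendsto _).comp hlimτ
    have hvC : (v, r) ∈ C := by
      refine ⟨hUc.mem_of_tendsto hlim1 (Eventually.of_forall fun _ => hu _),
        ge_of_tendsto' hlim2 fun _ => hg _, ?_⟩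
      have h3 : Tendsto (fun j => ((x (σ (τ j)), u (σ (τ j))), ENNReal.ofReal (g (σ (τ j)))))
          atTop (𝓝 ((x₀, v), ENNReal.ofReal r)) :=
        ((hx.comp ((hσ.comp hτ).tendsto_atTop)).prodMk_nhds hlim1).prodMk_nhds
          (ENNReal.tendsto_ofReal hlim2)
      exact hepi.mem_of_tendsto h3 (Eventually.of_forall fun j => hfg _)
    have h4 : φ v + d * r ≤ A := by
      refine le_of_tendsto' (((φ.continuous.tendsto v).comp hlim1).add (hlim2.const_mul d))
        fun j => ?_
      exact (hσA (τ j)).le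
    exact absurd (hA2 v r hvC) (not_lt.2 h4)
  obtain ⟨K, hK⟩ := eventually_atTop.1 hev
  -- The affine inequality survives averaging, since the indices in the `k`-th combination are all
  -- at least `k`. Its limit contradicts the separation of `(u₀, s)`.
  have hfreq' : ∃ᶠ k in atTop, A ≤ φ (∑ i, w k i • u (z k i)) + d * s := by
    refine (hfreq.and_eventually (eventually_ge_atTop K)).mono fun k hk => ?_
    calc A = ∑ i, w k i * A := by rw [← Finset.sum_mul, hw1, one_mul]
      _ ≤ ∑ i, w k i * (φ (u (z k i)) + d * g (z k i)) :=
        Finset.sum_le_sum fun i _ => mul_le_mul_of_nonneg_left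
          (hK _ (hk.2.trans (hz k i))) (hw k i)
      _ = φ (∑ i, w k i • u (z k i)) + d * ∑ i, w k i * g (z k i) := by
        simp only [map_sum, map_smul, smul_eq_mul, mul_add, Finset.sum_add_distrib, Finset.mul_sum]
        congr 1
        exact Finset.sum_congr rfl fun i _ => by ring
      _ ≤ _ := by gcongr; exact hk.1
  have h5 : A ≤ φ u₀ + d * s :=
    ge_of_tendsto_of_frequently (((φ.continuous.tendsto _).comp hlim).add_const _) hfreq'
  linarith

end LowerSemicontinuity

/-! ### Lower semicontinuity of integral functionals -/

section IntegralFunctional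

variable {α : Type*} [MeasurableSpace α] {μ : Measure α} {X : Type*} [TopologicalSpace X]
  {F : Type*} [NormedAddCommGroup F] [InnerProductSpace ℝ F] [FiniteDimensional ℝ F]

/-- Strong-weak lower semicontinuity of integral functionals. -/
theorem lintegral_le_of_tendsto_of_weak_tendsto [IsFiniteMeasure μ] {f : α → X → F → ℝ≥0∞}
    {U : Set F} (hU : Convex ℝ U) (hUc : IsClosed U)
    (hlsc : ∀ᵐ t ∂μ, LowerSemicontinuous (fun z : X × F => f t z.1 z.2))
    (hconv : ∀ᵐ t ∂μ, ∀ x, ConvexOn ℝ≥0 univ (f t x))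
    (hsup : ∀ᵐ t ∂μ, UniformlySuperlinear (f t) U)
    {x : ℕ → α → X} {x₀ : α → X} (hx : ∀ᵐ t ∂μ, Tendsto (fun k => x k t) atTop (𝓝 (x₀ t)))
    {u : ℕ → α → F} {u₀ : α → F} (hu : ∀ k, Integrable (u k) μ) (hu₀ : Integrable u₀ μ)
    (huU : ∀ k, ∀ᵐ t ∂μ, u k t ∈ U)
    (hweak : ∀ g : α → F, AEStronglyMeasurable g μ → (∃ C, ∀ᵐ t ∂μ, ‖g t‖ ≤ C) →
      Tendsto (fun k => ∫ t, inner ℝ (g t) (u k t) ∂μ) atTop (𝓝 (∫ t, inner ℝ (g t) (u₀ t) ∂μ)))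
    (hmeas : ∀ k, AEMeasurable (fun t => f t (x k t) (u k t)) μ)
    {c : ℝ≥0∞} (hc : c ≠ ∞) (hbound : ∀ k, ∫⁻ t, f t (x k t) (u k t) ∂μ ≤ c) :
    ∫⁻ t, f t (x₀ t) (u₀ t) ∂μ ≤ c := by
  choose ι hι w z hz hw hw1 hlim using fun k : ℕ =>
    exists_convexCombination_tendsto hu hu₀ hweak k (ε := 1 / ((k : ℝ) + 1)) (by positivity)
  have hLp : Tendsto (fun k => eLpNorm ((fun t => ∑ i, w k i • u (z k i) t) - u₀) 1 μ)
      atTop (𝓝 0) := by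
    refine tendsto_of_tendsto_of_tendsto_of_le_of_le tendsto_const_nhds
      (h := fun k : ℕ => ENNReal.ofReal (1 / ((k : ℝ) + 1))) ?_ (fun _ => zero_le) hlim
    simpa using ENNReal.tendsto_ofReal tendsto_one_div_add_atTop_nhds_zero_nat
  have hum : ∀ k, AEStronglyMeasurable (fun t => ∑ i, w k i • u (z k i) t) μ := fun k =>
    Finset.aestronglyMeasurable_fun_sum _ fun i _ => ((hu _).1.const_smul _)
  obtain ⟨σ, hσ, hσlim⟩ := (tendstoInMeasure_of_tendsto_eLpNorm one_ne_zero hum hu₀.1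
    hLp).exists_seq_tendsto_ae
  -- The Mazur weights are applied to the integrands themselves, so that the integral of each `G k`
  -- is still at most `c`. The states in the sum differ, so convexity in the control alone would not
  -- give the pointwise bound `hpt`.
  let G : ℕ → α → ℝ≥0∞ := fun k t => ∑ i, ENNReal.ofReal (w (σ k) i) *
    f t (x (z (σ k) i) t) (u (z (σ k) i) t)
  have hGm : ∀ k, AEMeasurable (G k) μ := fun k =>
    Finset.aemeasurable_fun_sum _ fun i _ => (hmeas _).const_mul _
  have hGint : ∀ k, ∫⁻ t, G k t ∂μ ≤ c := by
    intro k
    rw [lintegral_finsetSum' _ fun i _ => (hmeas _).const_mul _]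
    calc _ = ∑ i, ENNReal.ofReal (w (σ k) i) *
            ∫⁻ t, f t (x (z (σ k) i) t) (u (z (σ k) i) t) ∂μ :=
          Finset.sum_congr rfl fun i _ => lintegral_const_mul'' _ (hmeas _)
      _ ≤ ∑ i, ENNReal.ofReal (w (σ k) i) * c := by
          gcongr with i; exact hbound _
      _ = c := by
          rw [← Finset.sum_mul, ← ENNReal.ofReal_sum_of_nonneg fun i _ => hw _ i, hw1]
          simp
  have hfin : ∀ᵐ t ∂μ, ∀ k, f t (x k t) (u k t) < ∞ := ae_all_iff.2 fun k =>
    ae_lt_top' (hmeas k) ((hbound k).trans_lt hc.lt_top).ne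
  have hpt : ∀ᵐ t ∂μ, f t (x₀ t) (u₀ t) ≤ liminf (fun k => G k t) atTop := by
    filter_upwards [hlsc, hconv, hsup, hx, ae_all_iff.2 huU, hσlim, hfin]
      with t h1 h2 h3 h4 h5 h7 h8
    -- An intermediate finite level `s'` is passed infinitely often from below by `G k t`; this
    -- gives the real bound needed by the epigraph argument, even when the liminf is not attained.
    refine le_of_forall_gt fun s hs => ?_
    obtain ⟨s', hs1, hs2⟩ := exists_between hs
    refine lt_of_le_of_lt ?_ hs2
    have hs' : s' ≠ ∞ := (hs2.trans_le le_top).ne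
    have hfr : ∃ᶠ k in atTop, G k t < s' := frequently_lt_of_liminf_lt (by isBoundedDefault) hs1
    rw [← ENNReal.ofReal_toReal hs']
    refine le_of_convexCombinations_tendsto hU hUc h1 h3 h4 (h2 _) h5
      (g := fun i => (f t (x i t) (u i t)).toReal) (fun _ => ENNReal.toReal_nonneg)
      (fun i => (ENNReal.ofReal_toReal (h8 i).ne).ge) (ι := fun k => ι (σ k))
      (w := fun k => w (σ k)) (z := fun k => z (σ k)) (fun k => hw _) (fun k => hw1 _)
      (fun k i => (hσ.id_le k).trans (hz _ i)) h7 ENNReal.toReal_nonneg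
      (hfr.mono fun k hk => ?_)
    have : ∑ i, w (σ k) i * (f t (x (z (σ k) i) t) (u (z (σ k) i) t)).toReal = (G k t).toReal := by
      rw [ENNReal.toReal_sum fun i _ => ENNReal.mul_ne_top ENNReal.ofReal_ne_top (h8 _).ne]
      refine Finset.sum_congr rfl fun i _ => ?_
      rw [ENNReal.toReal_mul, ENNReal.toReal_ofReal (hw _ i)]
    rw [this]
    exact ENNReal.toReal_mono hs' hk.le
  calc ∫⁻ t, f t (x₀ t) (u₀ t) ∂μ ≤ ∫⁻ t, liminf (fun k => G k t) atTop ∂μ := lintegral_mono_ae hpt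
    _ ≤ liminf (fun k => ∫⁻ t, G k t ∂μ) atTop := lintegral_liminf_le' hGm
    _ ≤ c := liminf_le_of_le (by isBoundedDefault) fun b hb => by
        obtain ⟨k, hk⟩ := hb.exists
        exact hk.trans (hGint k)

end IntegralFunctional

/-! ### Absolutely continuous functions and primitives -/

section AbsoluteContinuity

variable {G : Type*} [NormedAddCommGroup G] [NormedSpace ℝ G]

/-- The primitive of an integrable function is absolutely continuous. -/
theorem absolutelyContinuousOnInterval_primitive {f : ℝ → G} {a b : ℝ}
    (hf : IntervalIntegrable f volume a b) :
    AbsolutelyContinuousOnInterval (fun t => ∫ s in a..t, f s) a b := by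
  -- The increments are dominated by those of the real-valued primitive of `‖f‖`.
  have hn := hf.norm.absolutelyContinuousOnInterval_intervalIntegral (c := a) left_mem_uIcc
  unfold AbsolutelyContinuousOnInterval at hn ⊢
  refine squeeze_zero' (Eventually.of_forall fun _ => Finset.sum_nonneg fun _ _ => dist_nonneg)
    ?_ hn
  rw [eventually_inf_principal]
  refine Eventually.of_forall fun I hI => Finset.sum_le_sum fun i hi => ?_
  obtain ⟨h1, h2⟩ := hI.1 i hi
  have hi1 := uIcc_subset_uIcc left_mem_uIcc h1
  have hi2 := uIcc_subset_uIcc left_mem_uIcc h2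
  simp only [dist_eq_norm]
  rw [intervalIntegral.integral_interval_sub_left (hf.mono_set hi1) (hf.mono_set hi2),
    intervalIntegral.integral_interval_sub_left (hf.norm.mono_set hi1) (hf.norm.mono_set hi2)]
  exact (intervalIntegral.norm_integral_le_abs_integral_norm).trans (Real.norm_eq_abs _).ge

theorem absolutelyContinuousOnInterval_congr {G : Type*} [PseudoMetricSpace G] {f g : ℝ → G} {a b : ℝ}
    (hf : AbsolutelyContinuousOnInterval f a b) (hfg : EqOn f g (uIcc a b)) :
    AbsolutelyContinuousOnInterval g a b := by
  unfold AbsolutelyContinuousOnInterval at hf ⊢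
  refine hf.congr' ?_
  rw [EventuallyEq, eventually_inf_principal]
  refine Eventually.of_forall fun I hI => Finset.sum_congr rfl fun i hi => ?_
  rw [hfg (hI.1 i hi).1, hfg (hI.1 i hi).2]

/-- An absolutely continuous function is the primitive of its derivative. -/
theorem eq_add_integral_of_absolutelyContinuousOnInterval [CompleteSpace G] {x f : ℝ → G} {τ : ℝ}
    (hx : AbsolutelyContinuousOnInterval x 0 τ)
    (hd : ∀ᵐ t ∂(volume.restrict (Ioo 0 τ)), HasDerivAt x (f t) t)
    (hf : IntervalIntegrable f volume 0 τ) {t : ℝ} (ht : t ∈ Icc 0 τ) :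
    x t = x 0 + ∫ s in (0 : ℝ)..t, f s := by
  have hτ : 0 ≤ τ := ht.1.trans ht.2
  have hac := hx.sub (absolutelyContinuousOnInterval_primitive hf)
  -- The derivative is known only on the open interval; `x` minus the primitive then has zero
  -- derivative almost everywhere and is constant.
  have hne : ∀ᵐ t : ℝ, t ≠ 0 ∧ t ≠ τ := by
    have h (c : ℝ) : ∀ᵐ t : ℝ, t ≠ c := by simp [ae_iff, measure_singleton]
    exact (h 0).and (h τ)
  rw [ae_restrict_iff' measurableSet_Ioo] at hd
  obtain ⟨C, hC⟩ := hac.const_of_ae_hasDerivAt_zero <| by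
    filter_upwards [hd, hf.ae_hasDerivAt_integral, hne] with t h1 h2 h3 h4
    have h5 := h4
    rw [uIcc_of_le hτ] at h5
    have h6 := (h1 ⟨lt_of_le_of_ne h5.1 h3.1.symm, lt_of_le_of_ne h5.2 h3.2⟩).sub
      (h2 h4 0 left_mem_uIcc)
    rwa [sub_self] at h6
  have h0 := hC 0 left_mem_uIcc
  have h1 := hC t (by rwa [uIcc_of_le hτ])
  simp only [Pi.sub_apply, intervalIntegral.integral_same, sub_zero] at h0 h1
  rw [h0, ← h1, sub_add_cancel]

end AbsoluteContinuity

/-! ### Measurability of superpositions -/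

section Superposition

variable {α : Type*} [MeasurableSpace α] {μ : Measure α}

/-- Superposition of a Carathéodory function and a measurable function is measurable. -/
theorem aestronglyMeasurable_superposition {X G : Type*} [PseudoEMetricSpace X]
    [MeasurableSpace X] [OpensMeasurableSpace X] [SecondCountableTopology X] [Nonempty X]
    [NormedAddCommGroup G] {g : α → X → G}
    (hg : ∀ x, AEStronglyMeasurable (fun t => g t x) μ)
    (hc : ∀ᵐ t ∂μ, Continuous (g t)) {y : α → X} (hy : AEMeasurable y μ) :
    AEStronglyMeasurable (fun t => g t (y t)) μ := by
  obtain ⟨y', hy', hyy'⟩ := hy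
  let x₀ : X := Classical.arbitrary X
  -- Along a simple function the superposition is a finite sum over its values; continuity of `g t`
  -- carries measurability to the limit.
  let σ := SimpleFunc.approxOn y' hy' univ x₀ (mem_univ _)
  have hσ : ∀ t, Tendsto (fun k => σ k t) atTop (𝓝 (y' t)) := fun t =>
    SimpleFunc.tendsto_approxOn hy' (mem_univ _) (by simp)
  have hm : ∀ k, AEStronglyMeasurable (fun t => g t (σ k t)) μ := by
    intro k
    classical
    have : (fun t => g t (σ k t)) =
        fun t => ∑ c ∈ (σ k).range, (σ k ⁻¹' {c}).indicator (fun t => g t c) t := by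
      ext t
      rw [Finset.sum_eq_single (σ k t)]
      · simp
      · intro c _ hne
        exact indicator_of_notMem (fun h => hne (by simpa using h.symm)) _
      · intro h
        exact absurd ((σ k).mem_range_self t) h
    rw [this]
    exact Finset.aestronglyMeasurable_fun_sum _ fun c _ =>
      (hg c).indicator ((σ k).measurableSet_preimage {c})
  refine aestronglyMeasurable_of_tendsto_ae atTop hm ?_
  filter_upwards [hc, hyy'] with t h1 h2
  rw [h2]
  exact (h1.tendsto _).comp (hσ t)

end Superposition

/-! ### Local bounds on the coefficients, and exponents -/

section StateEquation

variable {n m : ℕ} {a : ℝ → E n → E n} {b : ℝ → E n → E m →L[ℝ] E n}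

/-- The exceptional null set depends on the compact set; balls of integer radius exhaust the space,
so countably many null sets suffice. -/
theorem ae_continuous_of_lipschitz_on_compacts {G : Type*} [NormedAddCommGroup G]
    {g : ℝ → E n → G} (h : ∀ H : Set (E n), IsCompact H → ∃ A : ℝ → ℝ,
      ∀ᵐ t ∂halfLine, ∀ x₁ ∈ H, ∀ x₂ ∈ H, ‖g t x₁ - g t x₂‖ ≤ A t * ‖x₁ - x₂‖) :
    ∀ᵐ t ∂halfLine, Continuous (g t) := by
  choose A hA using fun k : ℕ => h (Metric.closedBall 0 k) (isCompact_closedBall 0 (k : ℝ))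
  filter_upwards [ae_all_iff.2 hA] with t ht
  refine continuous_iff_continuousAt.2 fun x => ?_
  obtain ⟨k, hk⟩ := exists_nat_gt ‖x‖
  have hl : LipschitzOnWith (A k t).toNNReal (g t) (Metric.closedBall 0 k) :=
    LipschitzOnWith.of_dist_le_mul fun x₁ h₁ x₂ h₂ => by
      rw [dist_eq_norm, dist_eq_norm]
      exact (ht k x₁ h₁ x₂ h₂).trans (by gcongr; exact Real.le_coe_toNNReal _)
  exact hl.continuousOn.continuousAt (mem_of_superset (Metric.isOpen_ball.mem_nhds (by simpa using hk))
    Metric.ball_subset_closedBall)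

theorem exists_bound_on_closedBall {G : Type*} [NormedAddCommGroup G] {s : ℝ≥0∞}
    {g : ℝ → E n → G} (h0 : ∃ M : ℝ → ℝ, LpLoc s M ∧ ∀ᵐ t ∂halfLine, ‖g t 0‖ ≤ M t)
    (h : ∀ H : Set (E n), IsCompact H → ∃ A : ℝ → ℝ, LpLoc s A ∧
      ∀ᵐ t ∂halfLine, ∀ x₁ ∈ H, ∀ x₂ ∈ H, ‖g t x₁ - g t x₂‖ ≤ A t * ‖x₁ - x₂‖) (ρ : ℝ) :
    ∃ B : ℝ → ℝ, LpLoc s B ∧ ∀ᵐ t ∂halfLine, ∀ x, ‖x‖ ≤ ρ → ‖g t x‖ ≤ B t := by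
  obtain ⟨M, hM, hM'⟩ := h0
  obtain ⟨A, hA, hA'⟩ := h (Metric.closedBall 0 ρ) (isCompact_closedBall 0 ρ)
  refine ⟨fun t => M t + |A t| * ρ, fun R => (hM R).add ((hA R).abs.mul_const ρ), ?_⟩
  filter_upwards [hM', hA'] with t h1 h2 x hx
  have h3 := h2 x (by simpa using hx) 0 (by simpa using (norm_nonneg x).trans hx)
  rw [sub_zero] at h3
  have h4 : A t * ‖x‖ ≤ |A t| * ρ := by
    gcongr
    exact le_abs_self _
  have h5 : ‖g t x‖ ≤ ‖g t x - g t 0‖ + ‖g t 0‖ := norm_le_norm_sub_add _ _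
  linarith

theorem LpLoc.mono_exponent {s r : ℝ≥0∞} {f : ℝ → ℝ} (hf : LpLoc r f) (h : s ≤ r) : LpLoc s f :=
  fun R => (hf R).mono_exponent h

/-- For finite `p`, `p/(p-1) ≤ p/(p-q) ≤ pq/(p-q)` because `q > 1`; for `p = ∞` it is `1 ≤ q`. This
puts the bounds on `b` in the dual exponent, where they pair with controls. -/
theorem conjExponent_le_gapExponent {p q : ℝ≥0∞} (hp : 1 < p) (hq : 1 < q) (hqp : q < p) :
    p.conjExponent ≤ gapExponent p q := by
  rw [ENNReal.conjExponent, gapExponent]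
  split_ifs with h
  · simp [h, hq.le]
  · rw [ENNReal.le_div_iff_mul_le (Or.inl (tsub_pos_of_lt hqp).ne')
      (Or.inl (ENNReal.sub_ne_top h))]
    have h1 : p - 1 ≠ 0 := (tsub_pos_of_lt hp).ne'
    calc (1 + (p - 1)⁻¹) * (p - q) ≤ (1 + (p - 1)⁻¹) * (p - 1) := by gcongr
      _ = p := by
        rw [add_mul, one_mul, ENNReal.inv_mul_cancel h1 (ENNReal.sub_ne_top h),
          tsub_add_cancel_of_le hp.le]
      _ ≤ p * q := le_mul_of_one_le_right' hq.le

end StateEquation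

theorem ae_restrict_Ioc_of_ae_halfLine {P : ℝ → Prop} (h : ∀ᵐ t ∂halfLine, P t) {s : ℝ}
    (hs : 0 ≤ s) (R : ℝ) : ∀ᵐ t ∂volume.restrict (Ioc s R), P t :=
  ae_mono (Measure.restrict_mono (fun _ h => lt_of_le_of_lt hs h.1) le_rfl) h

theorem restrict_Ioc_le_halfLine (R : ℝ) : volume.restrict (Ioc 0 R) ≤ halfLine :=
  Measure.restrict_mono Ioc_subset_Ioi_self le_rfl

/-! ### Hölder's inequality for operator-valued functions -/

section Holder

variable {α V W : Type*} [MeasurableSpace α] {μ : Measure α} [NormedAddCommGroup V]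
  [NormedSpace ℝ V] [NormedAddCommGroup W] [NormedSpace ℝ W]

theorem eLpNorm_one_apply_le {p p' : ℝ≥0∞} [p'.HolderConjugate p] {A : α → V →L[ℝ] W} {u : α → V}
    (hA : AEStronglyMeasurable A μ) (hu : AEStronglyMeasurable u μ) :
    eLpNorm (fun s => A s (u s)) 1 μ ≤ eLpNorm A p' μ * eLpNorm u p μ := by
  have := eLpNorm_le_eLpNorm_mul_eLpNorm_of_nnnorm (p := p') (q := p) (r := 1) hA hu
    (fun A v => A v) 1 (ae_of_all _ fun s => by simpa using (A s).le_opNNNorm (u s))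
  simpa using this

theorem aestronglyMeasurable_apply {A : α → V →L[ℝ] W} {u : α → V}
    (hA : AEStronglyMeasurable A μ) (hu : AEStronglyMeasurable u μ) :
    AEStronglyMeasurable (fun s => A s (u s)) μ :=
  isBoundedBilinearMap_apply.continuous.comp_aestronglyMeasurable (hA.prodMk hu)

end Holder

/-- The `L^s` norm over a short interval is small. -/
theorem exists_delta_eLpNorm_restrict_Ioc_le {f : ℝ → ℝ} {s : ℝ≥0∞} (hs1 : 1 ≤ s) (hs : s ≠ ∞)
    {R : ℝ} (hf : MemLp f s (volume.restrict (Icc 0 R))) {ε : ℝ} (hε : 0 < ε) :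
    ∃ δ > 0, ∀ t₁ t₂ : ℝ, 0 ≤ t₁ → t₂ ≤ R → t₂ - t₁ ≤ δ →
      eLpNorm f s (volume.restrict (Ioc t₁ t₂)) ≤ ENNReal.ofReal ε := by
  obtain ⟨δ, hδ, h⟩ := hf.eLpNorm_indicator_le hs1 hs hε
  refine ⟨δ, hδ, fun t₁ t₂ h1 h2 h3 => ?_⟩
  have hsub : Ioc t₁ t₂ ⊆ Icc 0 R := fun t ht => ⟨h1.trans ht.1.le, ht.2.trans h2⟩
  have h4 := h (Ioc t₁ t₂) measurableSet_Ioc <| by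
    refine (Measure.restrict_apply_le _ _).trans ?_
    rw [Real.volume_Ioc]
    exact ENNReal.ofReal_le_ofReal h3
  rwa [eLpNorm_indicator_eq_eLpNorm_restrict measurableSet_Ioc,
    Measure.restrict_restrict measurableSet_Ioc, inter_eq_left.2 hsub] at h4

/-! ### Equicontinuity and compactness of trajectories -/

section Trajectories

variable {n m : ℕ}

/-- The properties of the coefficients that are used for compactness of trajectories. -/
structure RegularSystem (a : ℝ → E n → E n) (b : ℝ → E n → E m →L[ℝ] E n) (s : ℝ≥0∞) : Prop where
  meas_a : ∀ x, AEStronglyMeasurable (fun t => a t x) halfLine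
  meas_b : ∀ x, AEStronglyMeasurable (fun t => b t x) halfLine
  cont_a : ∀ᵐ t ∂halfLine, Continuous (a t)
  cont_b : ∀ᵐ t ∂halfLine, Continuous (b t)
  bound_a : ∀ ρ : ℝ, ∃ A : ℝ → ℝ, LpLoc 1 A ∧ ∀ᵐ t ∂halfLine, ∀ x, ‖x‖ ≤ ρ → ‖a t x‖ ≤ A t
  bound_b : ∀ ρ : ℝ, ∃ B : ℝ → ℝ, LpLoc s B ∧ ∀ᵐ t ∂halfLine, ∀ x, ‖x‖ ≤ ρ → ‖b t x‖ ≤ B t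

/-- Compactness needs only continuity in the state and locally integrable bounds on balls, with
exponent 1 for `a` and exponent `s`, later the conjugate of `p`, for `b`. -/
theorem CaratheodoryLipschitz.regularSystem {a : ℝ → E n → E n} {b : ℝ → E n → E m →L[ℝ] E n}
    {q r s : ℝ≥0∞} (h : CaratheodoryLipschitz a b q r) (hq : 1 ≤ q) (hs : s ≤ r) :
    RegularSystem a b s where
  meas_a := h.meas_a
  meas_b := h.meas_b
  cont_a := ae_continuous_of_lipschitz_on_compacts fun H hH => (h.lip_a H hH).imp fun _ h => h.2
  cont_b := ae_continuous_of_lipschitz_on_compacts fun H hH => (h.lip_b H hH).imp fun _ h => h.2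
  bound_a ρ := (exists_bound_on_closedBall h.bound_a h.lip_a ρ).imp fun _ h =>
    ⟨h.1.mono_exponent hq, h.2⟩
  bound_b ρ := (exists_bound_on_closedBall h.bound_b h.lip_b ρ).imp fun _ h =>
    ⟨h.1.mono_exponent hs, h.2⟩

variable {a : ℝ → E n → E n} {b : ℝ → E n → E m →L[ℝ] E n} {p p' : ℝ≥0∞} [p'.HolderConjugate p]

omit [p'.HolderConjugate p] in
theorem RegularSystem.aestronglyMeasurable_a (hab : RegularSystem a b p') {R : ℝ} {y : ℝ → E n}
    (hy : AEMeasurable y (volume.restrict (Ioc 0 R))) :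
    AEStronglyMeasurable (fun t => a t (y t)) (volume.restrict (Ioc 0 R)) :=
  aestronglyMeasurable_superposition
    (fun x => (hab.meas_a x).mono_measure (restrict_Ioc_le_halfLine R))
    (ae_restrict_Ioc_of_ae_halfLine hab.cont_a le_rfl R) hy

omit [p'.HolderConjugate p] in
theorem RegularSystem.aestronglyMeasurable_b (hab : RegularSystem a b p') {R : ℝ} {y : ℝ → E n}
    (hy : AEMeasurable y (volume.restrict (Ioc 0 R))) :
    AEStronglyMeasurable (fun t => b t (y t)) (volume.restrict (Ioc 0 R)) :=
  aestronglyMeasurable_superposition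
    (fun x => (hab.meas_b x).mono_measure (restrict_Ioc_le_halfLine R))
    (ae_restrict_Ioc_of_ae_halfLine hab.cont_b le_rfl R) hy

theorem LpLoc.memLp_Ioc {s : ℝ≥0∞} {f : ℝ → ℝ} (hf : LpLoc s f) (R : ℝ) :
    MemLp f s (volume.restrict (Ioc 0 R)) :=
  (hf R).mono_measure (Measure.restrict_mono Ioc_subset_Icc_self le_rfl)

omit [p'.HolderConjugate p] in
theorem RegularSystem.integrable_a (hab : RegularSystem a b p') {R ρ : ℝ} {y : ℝ → E n}
    (hy : AEMeasurable y (volume.restrict (Ioc 0 R)))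
    (hyρ : ∀ᵐ t ∂volume.restrict (Ioc 0 R), ‖y t‖ ≤ ρ) :
    Integrable (fun t => a t (y t)) (volume.restrict (Ioc 0 R)) := by
  obtain ⟨A, hA, hA'⟩ := hab.bound_a ρ
  refine (memLp_one_iff_integrable.1 (hA.memLp_Ioc R)).mono' (hab.aestronglyMeasurable_a hy) ?_
  filter_upwards [ae_restrict_Ioc_of_ae_halfLine hA' le_rfl R, hyρ] with t h1 h2 using h1 _ h2

omit [p'.HolderConjugate p] in
theorem RegularSystem.memLp_b (hab : RegularSystem a b p') {R ρ : ℝ} {y : ℝ → E n}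
    (hy : AEMeasurable y (volume.restrict (Ioc 0 R)))
    (hyρ : ∀ᵐ t ∂volume.restrict (Ioc 0 R), ‖y t‖ ≤ ρ) :
    MemLp (fun t => b t (y t)) p' (volume.restrict (Ioc 0 R)) := by
  obtain ⟨B, hB, hB'⟩ := hab.bound_b ρ
  refine (hB.memLp_Ioc R).of_le (hab.aestronglyMeasurable_b hy) ?_
  filter_upwards [ae_restrict_Ioc_of_ae_halfLine hB' le_rfl R, hyρ] with t h1 h2
  exact (h1 _ h2).trans (le_abs_self _)

theorem RegularSystem.integrable_b (hab : RegularSystem a b p') {R ρ : ℝ} {y : ℝ → E n}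
    (hy : AEMeasurable y (volume.restrict (Ioc 0 R)))
    (hyρ : ∀ᵐ t ∂volume.restrict (Ioc 0 R), ‖y t‖ ≤ ρ) {u : ℝ → E m}
    (hu : MemLp u p (volume.restrict (Ioc 0 R))) :
    Integrable (fun t => b t (y t) (u t)) (volume.restrict (Ioc 0 R)) := by
  have hb := hab.memLp_b hy hyρ
  refine memLp_one_iff_integrable.1 ⟨aestronglyMeasurable_apply hb.1 hu.1, ?_⟩
  exact (eLpNorm_one_apply_le (p := p) (p' := p') hb.1 hu.1).trans_lt (ENNReal.mul_lt_top hb.2 hu.2)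

/-- Bounded solutions solve the integral equation. -/
theorem RegularSystem.integral_equation (hab : RegularSystem a b p') {ρ τ : ℝ} {u : ℝ → E m}
    {x₀ : E n} {x : ℝ → E n} (hτ : 0 ≤ τ) (hu : MemLp u p (volume.restrict (Ioc 0 τ)))
    (hx : IsSolutionOn a b u x₀ τ x) (hxρ : ∀ t ∈ Icc 0 τ, ‖x t‖ ≤ ρ) :
    AEMeasurable x (volume.restrict (Ioc 0 τ)) ∧
    IntervalIntegrable (fun t => a t (x t) + b t (x t) (u t)) volume 0 τ ∧
    ∀ t ∈ Icc 0 τ, x t = x₀ + ∫ s in (0 : ℝ)..t, (a s (x s) + b s (x s) (u s)) := by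
  obtain ⟨h0, hac, hd⟩ := hx
  have hm : AEMeasurable x (volume.restrict (Ioc 0 τ)) := by
    have := hac.continuousOn
    rw [uIcc_of_le hτ] at this
    exact (this.mono Ioc_subset_Icc_self).aemeasurable measurableSet_Ioc
  have hxρ' : ∀ᵐ t ∂volume.restrict (Ioc 0 τ), ‖x t‖ ≤ ρ :=
    (ae_restrict_mem measurableSet_Ioc).mono fun t ht => hxρ t (Ioc_subset_Icc_self ht)
  have hi : IntervalIntegrable (fun t => a t (x t) + b t (x t) (u t)) volume 0 τ :=
    (intervalIntegrable_iff_integrableOn_Ioc_of_le hτ).2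
      ((hab.integrable_a hm hxρ').add (hab.integrable_b hm hxρ' hu))
  refine ⟨hm, hi, fun t ht => ?_⟩
  rw [← h0]
  exact eq_add_integral_of_absolutelyContinuousOnInterval hac hd hi ht

/-- Equicontinuity of bounded trajectories with bounded controls. -/
theorem RegularSystem.equicontinuous (hab : RegularSystem a b p') (hp' : p' ≠ ∞)
    (ρ : ℝ) {C : ℝ≥0∞} (hC : C ≠ ∞) (R : ℝ) {ε : ℝ} (hε : 0 < ε) :
    ∃ δ > 0, ∀ (u : ℝ → E m) (x₀ : E n) (τ : ℝ) (x : ℝ → E n), R ≤ τ →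
      AEStronglyMeasurable u (volume.restrict (Ioc 0 τ)) →
      eLpNorm u p (volume.restrict (Ioc 0 τ)) ≤ C → IsSolutionOn a b u x₀ τ x →
      (∀ t ∈ Icc 0 τ, ‖x t‖ ≤ ρ) →
      ∀ t₁ ∈ Icc 0 R, ∀ t₂ ∈ Icc 0 R, |t₂ - t₁| ≤ δ → ‖x t₂ - x t₁‖ ≤ ε := by
  obtain ⟨A, hA, hA'⟩ := hab.bound_a ρ
  obtain ⟨B, hB, hB'⟩ := hab.bound_b ρ
  have hp1 : 1 ≤ p' := ENNReal.HolderTriple.le p' p 1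
  obtain ⟨δ₁, hδ₁, h₁⟩ := exists_delta_eLpNorm_restrict_Ioc_le le_rfl ENNReal.one_ne_top (hA R)
    (half_pos hε)
  have hC1 : 0 < C.toReal + 1 := by positivity
  -- By Hölder the control term contributes at most `‖B‖_{p'} · C`; the `+ 1` avoids division by
  -- zero. Smallness of the norm on short intervals needs `p' < ∞`.
  obtain ⟨δ₂, hδ₂, h₂⟩ := exists_delta_eLpNorm_restrict_Ioc_le hp1 hp' (hB R)
    (ε := ε / 2 / (C.toReal + 1)) (by positivity)
  refine ⟨min δ₁ δ₂, lt_min hδ₁ hδ₂, fun u x₀ τ x hR hum hu hx hxρ => ?_⟩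
  suffices h : ∀ t₁ t₂, 0 ≤ t₁ → t₁ ≤ t₂ → t₂ ≤ R → t₂ - t₁ ≤ min δ₁ δ₂ → ‖x t₂ - x t₁‖ ≤ ε by
    intro t₁ ht₁ t₂ ht₂ hd
    rcases le_total t₁ t₂ with h12 | h12
    · exact h t₁ t₂ ht₁.1 h12 ht₂.2 ((le_abs_self _).trans hd)
    · rw [norm_sub_rev]
      exact h t₂ t₁ ht₂.1 h12 ht₁.2 ((neg_sub t₂ t₁ ▸ neg_le_abs _).trans hd)
  intro t₁ t₂ h0 h12 h2R hd
  have hτ : 0 ≤ τ := h0.trans (h12.trans (h2R.trans hR))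
  obtain ⟨hm, hi, heq⟩ := hab.integral_equation hτ ⟨hum, hu.trans_lt hC.lt_top⟩ hx hxρ
  have e1 : x t₂ - x t₁ = ∫ s in Ioc t₁ t₂, (a s (x s) + b s (x s) (u s)) := by
    rw [heq t₂ ⟨h0.trans h12, h2R.trans hR⟩, heq t₁ ⟨h0, h12.trans (h2R.trans hR)⟩,
      add_sub_add_left_eq_sub, intervalIntegral.integral_interval_sub_left,
      intervalIntegral.integral_of_le h12]
    · exact hi.mono_set (uIcc_subset_uIcc left_mem_uIcc
        (mem_uIcc_of_le (h0.trans h12) (h2R.trans hR)))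
    · exact hi.mono_set (uIcc_subset_uIcc left_mem_uIcc
        (mem_uIcc_of_le h0 (h12.trans (h2R.trans hR))))
  have hsub : Ioc t₁ t₂ ⊆ Ioc 0 τ := Ioc_subset_Ioc h0 (h2R.trans hR)
  have hle : volume.restrict (Ioc t₁ t₂) ≤ volume.restrict (Ioc 0 τ) :=
    Measure.restrict_mono hsub le_rfl
  have hxb : ∀ᵐ t ∂volume.restrict (Ioc t₁ t₂), ‖x t‖ ≤ ρ :=
    (ae_restrict_mem measurableSet_Ioc).mono fun t ht => hxρ t (Ioc_subset_Icc_self (hsub ht))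
  have ha1 : eLpNorm (fun s => a s (x s)) 1 (volume.restrict (Ioc t₁ t₂)) ≤
      ENNReal.ofReal (ε / 2) := by
    refine le_trans ?_ (h₁ t₁ t₂ h0 h2R (hd.trans (min_le_left _ _)))
    refine eLpNorm_mono_ae ?_
    filter_upwards [ae_restrict_Ioc_of_ae_halfLine hA' h0 t₂, hxb] with t h3 h4
    exact (h3 _ h4).trans (le_abs_self _)
  have hb1 : eLpNorm (fun s => b s (x s)) p' (volume.restrict (Ioc t₁ t₂)) ≤
      ENNReal.ofReal (ε / 2 / (C.toReal + 1)) := by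
    refine le_trans ?_ (h₂ t₁ t₂ h0 h2R (hd.trans (min_le_right _ _)))
    refine eLpNorm_mono_ae ?_
    filter_upwards [ae_restrict_Ioc_of_ae_halfLine hB' h0 t₂, hxb] with t h3 h4
    exact (h3 _ h4).trans (le_abs_self _)
  have ham := (hab.aestronglyMeasurable_a hm).mono_measure hle
  have hbm := (hab.aestronglyMeasurable_b hm).mono_measure hle
  have hum' := hum.mono_measure hle
  have hbu : eLpNorm (fun s => b s (x s) (u s)) 1 (volume.restrict (Ioc t₁ t₂)) ≤
      ENNReal.ofReal (ε / 2) := by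
    calc _ ≤ _ := eLpNorm_one_apply_le (p := p) (p' := p') hbm hum'
      _ ≤ ENNReal.ofReal (ε / 2 / (C.toReal + 1)) * ENNReal.ofReal (C.toReal + 1) := by
          gcongr
          refine (eLpNorm_mono_measure _ hle).trans (hu.trans ?_)
          rw [← ENNReal.ofReal_toReal hC]
          exact ENNReal.ofReal_le_ofReal (by simp)
      _ = ENNReal.ofReal (ε / 2) := by
          rw [← ENNReal.ofReal_mul (by positivity), div_mul_cancel₀ _ hC1.ne']
  have : ‖x t₂ - x t₁‖ₑ ≤ ENNReal.ofReal ε := by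
    rw [e1]
    refine (enorm_integral_le_lintegral_enorm _).trans ?_
    rw [← eLpNorm_one_eq_lintegral_enorm]
    refine (eLpNorm_add_le ham (aestronglyMeasurable_apply hbm hum') le_rfl).trans ?_
    refine (add_le_add ha1 hbu).trans ?_
    rw [← ENNReal.ofReal_add (by positivity) (by positivity), add_halves]
  rwa [← ofReal_norm, ENNReal.ofReal_le_ofReal_iff hε.le] at this

/-- A sequence of bounded functions on growing intervals that is equicontinuous on compact intervals
has a subsequence that converges pointwise on `[0, ∞)`. -/
theorem exists_subseq_tendsto_of_equicontinuous {x : ℕ → ℝ → E n} {T : ℕ → ℝ}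
    (hT : Tendsto T atTop atTop) {ρ : ℝ} (hρ : 0 ≤ ρ) (hb : ∀ k, ∀ t ∈ Icc 0 (T k), ‖x k t‖ ≤ ρ)
    (he : ∀ R ε : ℝ, 0 < ε → ∃ δ > 0, ∀ k, R ≤ T k → ∀ t₁ ∈ Icc 0 R, ∀ t₂ ∈ Icc 0 R,
      |t₂ - t₁| ≤ δ → ‖x k t₂ - x k t₁‖ ≤ ε) :
    ∃ φ : ℕ → ℕ, StrictMono φ ∧ ∃ y : ℝ → E n, ∀ t, 0 ≤ t →
      Tendsto (fun k => x (φ k) t) atTop (𝓝 (y t)) := by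
  classical
  -- Restriction to rational times, with default value 0 outside the interval of existence, places
  -- the sequence in a countable product of balls, which is sequentially compact. Equicontinuity
  -- then extends convergence to all times.
  let z : ℕ → ℚ → E n := fun k r => if (r : ℝ) ∈ Icc 0 (T k) then x k r else 0
  have hcpt : IsCompact (univ.pi fun _ : ℚ => Metric.closedBall (0 : E n) ρ) :=
    isCompact_univ_pi fun _ => isCompact_closedBall 0 ρ
  obtain ⟨z₀, -, φ, hφ, hlim⟩ := hcpt.tendsto_subseq (x := z) fun k r _ => by
    simp only [z]
    split_ifs with h
    · simpa using hb k r h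
    · simpa using hρ
  have hTφ : Tendsto (fun k => T (φ k)) atTop atTop := hT.comp hφ.tendsto_atTop
  have hrat : ∀ r : ℚ, (0 : ℝ) ≤ r → Tendsto (fun k => x (φ k) r) atTop (𝓝 (z₀ r)) := by
    intro r hr
    refine (tendsto_pi_nhds.1 hlim r).congr' ?_
    filter_upwards [hTφ.eventually_ge_atTop (r : ℝ)] with k hk
    simp only [z, Function.comp_apply]
    rw [if_pos ⟨hr, hk⟩]
  have hc : ∀ t, 0 ≤ t → ∃ y, Tendsto (fun k => x (φ k) t) atTop (𝓝 y) := by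
    intro t ht
    refine cauchySeq_tendsto_of_complete (Metric.cauchySeq_iff'.2 fun ε hε => ?_)
    obtain ⟨δ, hδ, hδ'⟩ := he (t + 1) (ε / 4) (by positivity)
    -- Choosing `r` to the right of `t` and within distance 1 keeps it in `[0, t + 1]`. The error
    -- budget is `ε/4 + ε/8 + ε/8 + ε/4 < ε`.
    obtain ⟨r, hr1, hr2⟩ := exists_rat_btwn (lt_add_of_pos_right t (lt_min hδ one_pos))
    have hr0 : (0 : ℝ) ≤ r := ht.trans hr1.le
    obtain ⟨N₂, hN₂⟩ := eventually_atTop.1 (hTφ.eventually_ge_atTop (t + 1))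
    obtain ⟨N₃, hN₃⟩ := eventually_atTop.1
      ((hrat r hr0).eventually (Metric.ball_mem_nhds (z₀ r) (ε := ε / 8) (by positivity)))
    have hclose : ∀ k ≥ N₂, ‖x (φ k) r - x (φ k) t‖ ≤ ε / 4 := fun k hk => by
      refine hδ' _ (hN₂ k hk) t ⟨ht, by linarith⟩ r ⟨hr0, ?_⟩ ?_
      · linarith [min_le_right δ 1]
      · rw [abs_of_pos (by linarith)]
        linarith [min_le_left δ 1]
    refine ⟨max N₂ N₃, fun k hk => ?_⟩
    have h1 := hclose k ((le_max_left _ _).trans hk)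
    have h2 := hclose (max N₂ N₃) (le_max_left _ _)
    have h3 := hN₃ k ((le_max_right _ _).trans hk)
    have h4 := hN₃ (max N₂ N₃) (le_max_right _ _)
    rw [← dist_eq_norm] at h1 h2
    calc dist (x (φ k) t) (x (φ (max N₂ N₃)) t)
        ≤ dist (x (φ k) t) (x (φ k) r) + dist (x (φ k) r) (z₀ r) +
          dist (z₀ r) (x (φ (max N₂ N₃)) r) + dist (x (φ (max N₂ N₃)) r) (x (φ (max N₂ N₃)) t) := by
          refine (dist_triangle _ (x (φ (max N₂ N₃)) r) _).trans ?_
          gcongr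
          exact dist_triangle4 _ _ _ _
      _ < ε := by
          rw [dist_comm (x (φ k) t), dist_comm (z₀ r)]
          linarith
  choose! y hy using hc
  exact ⟨φ, hφ, y, hy⟩

end Trajectories

theorem tendsto_of_forall_inner_tendsto {n : ℕ} {f : ℕ → E n} {l : E n}
    (h : ∀ e : E n, Tendsto (fun k => inner ℝ e (f k)) atTop (𝓝 (inner ℝ e l))) :
    Tendsto f atTop (𝓝 l) := by
  have h1 : Tendsto (fun k => (f k).ofLp) atTop (𝓝 l.ofLp) := by
    refine tendsto_pi_nhds.2 fun i => ?_
    simpa [EuclideanSpace.inner_single_left] using h (EuclideanSpace.single i 1)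
  exact ((PiLp.continuous_toLp 2 _).tendsto _).comp h1

/-! ### Passage to the limit in the state equation -/

section Trajectories

variable {n m : ℕ} {a : ℝ → E n → E n} {b : ℝ → E n → E m →L[ℝ] E n} {p p' : ℝ≥0∞}
  [p'.HolderConjugate p]

/-- Weak convergence against a fixed matrix-valued function. -/
theorem tendsto_integral_apply_of_weak {u : ℕ → ℝ → E m} {u₀ : ℝ → E m} {R : ℝ}
    (hu : ∀ᶠ k in atTop, MemLp (u k) p (volume.restrict (Ioc 0 R)))
    (hu₀ : MemLp u₀ p (volume.restrict (Ioc 0 R)))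
    (hweak : ∀ g : ℝ → E m, MemLp g p' halfLine → Tendsto
      (fun k => ∫ t in Ioc 0 R, inner ℝ (g t) (u k t)) atTop
      (𝓝 (∫ t in Ioc 0 R, inner ℝ (g t) (u₀ t))))
    {B : ℝ → E m →L[ℝ] E n} (hB : MemLp B p' (volume.restrict (Ioc 0 R))) :
    Tendsto (fun k => ∫ t in Ioc 0 R, B t (u k t)) atTop (𝓝 (∫ t in Ioc 0 R, B t (u₀ t))) := by
  refine tendsto_of_forall_inner_tendsto fun e => ?_
  -- Since `⟨e, B u⟩ = ⟨B* e, u⟩`, each component of the integral is a pairing of the control with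
  -- one fixed test function.
  let g : ℝ → E m := (Ioc 0 R).indicator fun t => ContinuousLinearMap.adjoint (B t) e
  have hg : MemLp g p' halfLine := by
    rw [memLp_indicator_iff_restrict measurableSet_Ioc, halfLine,
      Measure.restrict_restrict measurableSet_Ioc, inter_eq_left.2 Ioc_subset_Ioi_self]
    refine MemLp.of_le_mul (c := ‖e‖) hB ?_ (ae_of_all _ fun t => ?_)
    · have h1 : Continuous fun A : E m →L[ℝ] E n => ContinuousLinearMap.adjoint A e :=
        (ContinuousLinearMap.adjoint (𝕜 := ℝ) (E := E m) (F := E n)).continuous.clm_apply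
          continuous_const
      exact h1.comp_aestronglyMeasurable hB.1
    · rw [mul_comm]
      refine (ContinuousLinearMap.le_opNorm _ _).trans ?_
      rw [LinearIsometryEquiv.norm_map]
  have hi : ∀ v : ℝ → E m, MemLp v p (volume.restrict (Ioc 0 R)) →
      inner ℝ e (∫ t in Ioc 0 R, B t (v t)) = ∫ t in Ioc 0 R, inner ℝ (g t) (v t) := by
    intro v hv
    have hint : Integrable (fun t => B t (v t)) (volume.restrict (Ioc 0 R)) :=
      memLp_one_iff_integrable.1 ⟨aestronglyMeasurable_apply hB.1 hv.1,
        (eLpNorm_one_apply_le (p := p) (p' := p') hB.1 hv.1).trans_lt (ENNReal.mul_lt_top hB.2 hv.2)⟩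
    rw [← integral_inner hint]
    refine setIntegral_congr_fun measurableSet_Ioc fun t ht => ?_
    simp only [g, indicator_of_mem ht, ContinuousLinearMap.adjoint_inner_left]
  rw [hi u₀ hu₀]
  refine (hweak g hg).congr' ?_
  filter_upwards [hu] with k hk
  rw [hi _ hk]

/-- Bounded trajectories with weakly convergent controls have a subsequence that converges
pointwise to a trajectory of the limit control. -/
theorem RegularSystem.exists_limit_trajectory (hab : RegularSystem a b p') (hp' : p' ≠ ∞)
    {u : ℕ → ℝ → E m} {u₀ : ℝ → E m} {x₀ : E n} {x : ℕ → ℝ → E n} {T : ℕ → ℝ} {ρ : ℝ} {C : ℝ≥0∞}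
    (hT : Tendsto T atTop atTop) (hT0 : ∀ k, 0 ≤ T k) (hC : C ≠ ∞)
    (hum : ∀ k, AEStronglyMeasurable (u k) halfLine)
    (huC : ∀ k, eLpNorm (u k) p (volume.restrict (Ioc 0 (T k))) ≤ C)
    (hu₀ : MemLp u₀ p halfLine)
    (hweak : ∀ R : ℝ, ∀ g : ℝ → E m, MemLp g p' halfLine → Tendsto
      (fun k => ∫ t in Ioc 0 R, inner ℝ (g t) (u k t)) atTop
      (𝓝 (∫ t in Ioc 0 R, inner ℝ (g t) (u₀ t))))
    (hsol : ∀ k, IsSolutionOn a b (u k) x₀ (T k) (x k))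
    (hbd : ∀ k, ∀ t ∈ Icc 0 (T k), ‖x k t‖ ≤ ρ) :
    ∃ φ : ℕ → ℕ, StrictMono φ ∧ ∃ y : ℝ → E n, (∀ R, 0 ≤ R → IsSolutionOn a b u₀ x₀ R y) ∧
      ∀ t, 0 ≤ t → Tendsto (fun k => x (φ k) t) atTop (𝓝 (y t)) := by
  have humT : ∀ k, MemLp (u k) p (volume.restrict (Ioc 0 (T k))) := fun k =>
    ⟨(hum k).mono_measure (restrict_Ioc_le_halfLine _), (huC k).trans_lt hC.lt_top⟩
  have hρ : 0 ≤ ρ := (norm_nonneg _).trans (hbd 0 0 ⟨le_rfl, hT0 0⟩)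
  obtain ⟨φ, hφ, y, hy⟩ := exists_subseq_tendsto_of_equicontinuous hT hρ hbd fun R ε hε => by
    obtain ⟨δ, hδ, h⟩ := hab.equicontinuous (p := p) hp' ρ hC R hε
    exact ⟨δ, hδ, fun k hk => h (u k) x₀ (T k) (x k) hk (humT k).1 (huC k) (hsol k) (hbd k)⟩
  have hTφ : Tendsto (fun k => T (φ k)) atTop atTop := hT.comp hφ.tendsto_atTop
  -- Extension by zero makes the trajectories measurable and bounded by `ρ` on the whole line, as
  -- dominated convergence requires.
  let z : ℕ → ℝ → E n := fun k => (Icc 0 (T (φ k))).indicator (x (φ k))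
  have hzm : ∀ k, AEMeasurable (z k) volume := fun k => by
    refine (aemeasurable_indicator_iff measurableSet_Icc).2 ?_
    have := (hsol (φ k)).2.1.continuousOn
    rw [uIcc_of_le (hT0 _)] at this
    exact this.aemeasurable measurableSet_Icc
  have hzb : ∀ k t, ‖z k t‖ ≤ ρ := fun k t => by
    by_cases ht : t ∈ Icc 0 (T (φ k))
    · simpa only [z, indicator_of_mem ht] using hbd _ t ht
    · simpa only [z, indicator_of_notMem ht, norm_zero] using hρ
  have hzy : ∀ t, 0 ≤ t → Tendsto (fun k => z k t) atTop (𝓝 (y t)) := fun t ht => by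
    refine (hy t ht).congr' ?_
    filter_upwards [hTφ.eventually_ge_atTop t] with k hk
    simp only [z, indicator_of_mem (show t ∈ Icc 0 (T (φ k)) from ⟨ht, hk⟩)]
  have hyb : ∀ t, 0 ≤ t → ‖y t‖ ≤ ρ := fun t ht =>
    le_of_tendsto' (hzy t ht).norm fun k => hzb k t
  have haeIoc : ∀ R : ℝ, ∀ᵐ t ∂volume.restrict (Ioc 0 R), 0 ≤ t := fun R =>
    (ae_restrict_mem measurableSet_Ioc).mono fun t ht => ht.1.le
  have hym : ∀ R : ℝ, AEMeasurable y (volume.restrict (Ioc 0 R)) := fun R =>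
    aemeasurable_of_tendsto_metrizable_ae atTop (fun k => (hzm k).restrict)
      ((haeIoc R).mono fun t ht => hzy t ht)
  have hybR : ∀ R : ℝ, ∀ᵐ t ∂volume.restrict (Ioc 0 R), ‖y t‖ ≤ ρ := fun R =>
    (haeIoc R).mono hyb
  have hu₀R : ∀ R : ℝ, MemLp u₀ p (volume.restrict (Ioc 0 R)) := fun R =>
    hu₀.mono_measure (restrict_Ioc_le_halfLine R)
  have hlimit : ∀ t, 0 ≤ t →
      y t = x₀ + ((∫ s in Ioc 0 t, a s (y s)) + ∫ s in Ioc 0 t, b s (y s) (u₀ s)) := by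
    intro t ht
    have hev : ∀ᶠ k in atTop, t ≤ T (φ k) := hTφ.eventually_ge_atTop t
    have hut : ∀ᶠ k in atTop, MemLp (u (φ k)) p (volume.restrict (Ioc 0 t)) ∧
        eLpNorm (u (φ k)) p (volume.restrict (Ioc 0 t)) ≤ C := by
      filter_upwards [hev] with k hk
      have hle : volume.restrict (Ioc 0 t) ≤ volume.restrict (Ioc 0 (T (φ k))) :=
        Measure.restrict_mono (Ioc_subset_Ioc_right hk) le_rfl
      exact ⟨(humT _).mono_measure hle, (eLpNorm_mono_measure _ hle).trans (huC _)⟩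
    have hzbt : ∀ k, ∀ᵐ s ∂volume.restrict (Ioc 0 t), ‖z k s‖ ≤ ρ := fun k =>
      ae_of_all _ (hzb k)
    have heq : ∀ᶠ k in atTop, x (φ k) t = x₀ + ((∫ s in Ioc 0 t, a s (z k s)) +
        ∫ s in Ioc 0 t, b s (z k s) (u (φ k) s)) := by
      filter_upwards [hev, hut] with k hk hk2
      rw [(hab.integral_equation (hT0 _) (humT _) (hsol _) (hbd _)).2.2 t ⟨ht, hk⟩,
        ← integral_add (hab.integrable_a (hzm k).restrict (hzbt k))
          (hab.integrable_b (hzm k).restrict (hzbt k) hk2.1), intervalIntegral.integral_of_le ht]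
      congr 1
      refine setIntegral_congr_fun measurableSet_Ioc fun s hs => ?_
      simp only [z, indicator_of_mem (show s ∈ Icc 0 (T (φ k)) from ⟨hs.1.le, hs.2.trans hk⟩)]
    have hA : Tendsto (fun k => ∫ s in Ioc 0 t, a s (z k s)) atTop
        (𝓝 (∫ s in Ioc 0 t, a s (y s))) := by
      obtain ⟨A, hA, hA'⟩ := hab.bound_a ρ
      refine tendsto_integral_of_dominated_convergence A
        (fun k => hab.aestronglyMeasurable_a (hzm k).restrict)
        (memLp_one_iff_integrable.1 (hA.memLp_Ioc t)) (fun k => ?_) ?_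
      · filter_upwards [ae_restrict_Ioc_of_ae_halfLine hA' le_rfl t] with s hs
        exact hs _ (hzb k s)
      · filter_upwards [ae_restrict_Ioc_of_ae_halfLine hab.cont_a le_rfl t, haeIoc t] with s h1 h2
        exact (h1.tendsto _).comp (hzy s h2)
    have hD : Tendsto (fun k => eLpNorm (fun s => b s (z k s) - b s (y s)) p'
        (volume.restrict (Ioc 0 t))) atTop (𝓝 0) := by
      obtain ⟨B, hB, hB'⟩ := hab.bound_b ρ
      refine tendsto_eLpNorm_zero_of_dominated (Φ := fun s => B s + B s)
        (ENNReal.HolderConjugate.ne_zero p' p) hp'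
        (Eventually.of_forall fun k => (hab.aestronglyMeasurable_b (hzm k).restrict).sub
          (hab.aestronglyMeasurable_b (hym t)))
        ((hB.memLp_Ioc t).add (hB.memLp_Ioc t)) (Eventually.of_forall fun k => ?_) ?_
      · filter_upwards [ae_restrict_Ioc_of_ae_halfLine hB' le_rfl t, haeIoc t] with s h1 h2
        exact (norm_sub_le _ _).trans (add_le_add (h1 _ (hzb k s)) (h1 _ (hyb s h2)))
      · filter_upwards [ae_restrict_Ioc_of_ae_halfLine hab.cont_b le_rfl t, haeIoc t] with s h1 h2
        have := ((h1.tendsto _).comp (hzy s h2)).sub_const (b s (y s))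
        rwa [sub_self] at this
    -- The product is split: replacing `b(·, z_k)` by `b(·, y)` costs at most a vanishing dual norm
    -- times `C`, and what remains is a weak limit against fixed coefficients.
    have hB1 : Tendsto (fun k => (∫ s in Ioc 0 t, b s (z k s) (u (φ k) s)) -
        ∫ s in Ioc 0 t, b s (y s) (u (φ k) s)) atTop (𝓝 0) := by
      rw [tendsto_zero_iff_enorm_tendsto_zero]
      have hDC := ENNReal.Tendsto.mul_const hD (Or.inr hC)
      rw [zero_mul] at hDC
      refine tendsto_of_tendsto_of_tendsto_of_le_of_le' tendsto_const_nhds hDC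
        (Eventually.of_forall fun _ => zero_le) ?_
      filter_upwards [hut] with k hk
      have hi1 := hab.integrable_b (hzm k).restrict (hzbt k) hk.1
      have hi2 := hab.integrable_b (hym t) (hybR t) hk.1
      rw [← integral_sub hi1 hi2]
      refine (enorm_integral_le_lintegral_enorm _).trans ?_
      rw [← eLpNorm_one_eq_lintegral_enorm]
      refine le_trans ?_ (mul_le_mul_right hk.2 _)
      exact eLpNorm_one_apply_le (A := fun s => b s (z k s) - b s (y s))
        ((hab.aestronglyMeasurable_b (hzm k).restrict).sub (hab.aestronglyMeasurable_b (hym t)))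
        hk.1.1
    have hB2 : Tendsto (fun k => ∫ s in Ioc 0 t, b s (y s) (u (φ k) s)) atTop
        (𝓝 (∫ s in Ioc 0 t, b s (y s) (u₀ s))) :=
      tendsto_integral_apply_of_weak (hut.mono fun k hk => hk.1) (hu₀R t)
        (fun g hg => (hweak t g hg).comp hφ.tendsto_atTop) (hab.memLp_b (hym t) (hybR t))
    have hB3 := hB1.add hB2
    simp only [sub_add_cancel, zero_add] at hB3
    exact tendsto_nhds_unique ((hy t ht).congr' heq) ((hA.add hB3).const_add x₀)
  let f : ℝ → E n := fun s => a s (y s) + b s (y s) (u₀ s)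
  have hfi : ∀ R, 0 ≤ R → IntervalIntegrable f volume 0 R := fun R hR =>
    (intervalIntegrable_iff_integrableOn_Ioc_of_le hR).2
      ((hab.integrable_a (hym R) (hybR R)).add (hab.integrable_b (hym R) (hybR R) (hu₀R R)))
  -- The limit `y` is controlled only at nonnegative times; the primitive agrees with it there and
  -- has the required regularity by construction.
  let Y : ℝ → E n := fun t => x₀ + ∫ s in (0 : ℝ)..t, f s
  have hY : ∀ t, 0 ≤ t → y t = Y t := fun t ht => by
    simp only [Y]
    rw [hlimit t ht, intervalIntegral.integral_of_le ht,
      ← integral_add (hab.integrable_a (hym t) (hybR t))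
        (hab.integrable_b (hym t) (hybR t) (hu₀R t))]
  refine ⟨φ, hφ, Y, fun R hR => ⟨by simp [Y], ?_, ?_⟩, fun t ht => by rw [← hY t ht]; exact hy t ht⟩
  · have hconst : AbsolutelyContinuousOnInterval (fun _ : ℝ => x₀) 0 R :=
      (LipschitzWith.const x₀).lipschitzOnWith.absolutelyContinuousOnInterval
    exact hconst.add (absolutelyContinuousOnInterval_primitive (hfi R hR))
  · rw [ae_restrict_iff' measurableSet_Ioo]
    filter_upwards [(hfi R hR).ae_hasDerivAt_integral] with t h1 h2
    have h3 : t ∈ uIcc 0 R := by rw [uIcc_of_le hR]; exact Ioo_subset_Icc_self h2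
    have h4 := (h1 h3 0 left_mem_uIcc).const_add x₀
    rw [← hY t h2.1.le]
    exact h4

end Trajectories

/-! ### Weak-star convergence of controls -/

section WeakStar

variable {m : ℕ} {p : ℝ≥0∞} {U : Set (E m)}

theorem tendsto_integral_of_tendsto_control {v : ℕ → Control m p U} {v₀ : Control m p U}
    (hv : Tendsto v atTop (𝓝 v₀)) (g : Lp (E m) p.conjExponent halfLine) :
    Tendsto (fun k => ∫ t, inner ℝ (g t) (v k t) ∂halfLine) atTop
      (𝓝 (∫ t, inner ℝ (g t) (v₀ t) ∂halfLine)) := by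
  have h := (continuous_induced_dom.tendsto v₀).comp hv
  exact tendsto_pi_nhds.1 h g

/-- The pairing is continuous along strongly convergent and weak-star convergent sequences. -/
theorem tendsto_integral_of_strong_of_weak (hp : 1 ≤ p) {v : ℕ → Control m p U}
    {v₀ : Control m p U} (hv : Tendsto v atTop (𝓝 v₀)) {g : ℕ → ℝ → E m} {g₀ : ℝ → E m}
    (hg : ∀ k, MemLp (g k) p.conjExponent halfLine) (hg₀ : MemLp g₀ p.conjExponent halfLine)
    (hlim : Tendsto (fun k => eLpNorm (g k - g₀) p.conjExponent halfLine) atTop (𝓝 0)) :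
    Tendsto (fun k => ∫ t, inner ℝ (g k t) (v k t) ∂halfLine) atTop
      (𝓝 (∫ t, inner ℝ (g₀ t) (v₀ t) ∂halfLine)) := by
  have : Fact (1 ≤ p) := ⟨hp⟩
  have hpp : p.conjExponent.HolderConjugate p := inferInstance
  have : Fact (1 ≤ p.conjExponent) := ⟨ENNReal.HolderTriple.le p.conjExponent p 1⟩
  -- Viewed as functionals on the dual-exponent space, the controls converge pointwise, so
  -- Banach–Steinhaus bounds them uniformly and `⟨g_k - g₀, v_k⟩` tends to 0.
  let L : Control m p U → Lp (E m) p.conjExponent halfLine →L[ℝ] ℝ := fun w =>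
    ((innerSL ℝ).lpPairing halfLine p.conjExponent p).flip w.toLp
  have hL : ∀ w (h : ℝ → E m) (hh : MemLp h p.conjExponent halfLine),
      L w hh.toLp = ∫ t, inner ℝ (h t) (w t) ∂halfLine := by
    intro w h hh
    have h1 : L w hh.toLp = (innerSL ℝ).lpPairing halfLine p.conjExponent p hh.toLp w.toLp := rfl
    rw [h1, ContinuousLinearMap.lpPairing_eq_integral]
    refine integral_congr_ae ?_
    filter_upwards [hh.coeFn_toLp] with t ht
    rw [ht]; rfl
  have hLg : ∀ w (h : Lp (E m) p.conjExponent halfLine),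
      L w h = ∫ t, inner ℝ (h t) (w t) ∂halfLine := fun w h => by
    rw [← hL w h (Lp.memLp h), Lp.toLp_coeFn]
  obtain ⟨C, hC⟩ := banach_steinhaus (g := fun k => L (v k)) fun h => by
    have h1 := tendsto_integral_of_tendsto_control hv h
    obtain ⟨C, hC⟩ := h1.norm.bddAbove_range
    exact ⟨C, fun k => by rw [hLg]; exact hC ⟨k, rfl⟩⟩
  have h2 : Tendsto (fun k => L (v k) ((hg k).toLp - hg₀.toLp)) atTop (𝓝 0) := by
    have h3 : Tendsto (fun k => ‖(hg k).toLp - hg₀.toLp‖) atTop (𝓝 0) := by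
      have := (ENNReal.tendsto_toReal ENNReal.zero_ne_top).comp hlim
      refine this.congr fun k => ?_
      rw [← MemLp.toLp_sub, Lp.norm_toLp, Function.comp_apply]
    refine squeeze_zero_norm (fun k => ?_) (by simpa using h3.const_mul C)
    exact ((L (v k)).le_opNorm _).trans (by gcongr; exact hC k)
  have h4 : Tendsto (fun k => L (v k) hg₀.toLp) atTop (𝓝 (L v₀ hg₀.toLp)) := by
    simp only [hLg]
    exact tendsto_integral_of_tendsto_control hv _
  have h5 := h2.add h4
  rw [zero_add, hL] at h5
  refine h5.congr fun k => ?_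
  rw [← map_add, sub_add_cancel, hL]

end WeakStar

/-! ### Piecewise controls with moving switching times -/

section Piecewise

variable {m N : ℕ}

/-- The `j`-th interval of a partition with endpoints in the extended reals. -/
def cell (τ : Fin (N + 1) → EReal) (j : Fin N) : Set ℝ :=
  {s : ℝ | τ j.castSucc ≤ (s : EReal) ∧ (s : EReal) < τ j.succ}

theorem measurableSet_cell (τ : Fin (N + 1) → EReal) (j : Fin N) : MeasurableSet (cell τ j) :=
  (measurableSet_le measurable_const measurable_coe_real_ereal).inter
    (measurableSet_lt measurable_coe_real_ereal measurable_const)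

/-- The active cell starts at the largest index whose endpoint is at most `t`; this choice skips
empty cells when endpoints coincide. Consequently a piecewise control takes values in `U`. -/
theorem exists_piecewise_eq {τ : Fin (N + 1) → EReal} (hτ : Monotone τ) {t : ℝ}
    (h0 : τ 0 ≤ t) (hN : (t : EReal) < τ (Fin.last N)) :
    ∃ j : Fin N, ∀ v : Fin N → ℝ → E m, piecewise v τ t = v j t := by
  classical
  obtain ⟨i, hi1, hi2⟩ : ∃ i : Fin (N + 1), τ i ≤ t ∧ ∀ i', τ i' ≤ t → i' ≤ i := by
    have hne : (Finset.univ.filter fun i => τ i ≤ (t : EReal)).Nonempty := ⟨0, by simpa using h0⟩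
    refine ⟨Finset.max' _ hne, ?_, fun i' hi' => Finset.le_max' _ _ (by simpa using hi')⟩
    simpa using Finset.max'_mem _ hne
  have hlast : i ≠ Fin.last N := fun h => not_le.2 hN (h ▸ hi1)
  obtain ⟨j, rfl⟩ := Fin.exists_castSucc_eq.2 hlast
  have hj : (t : EReal) < τ j.succ := by
    by_contra h
    exact absurd (hi2 _ (not_lt.1 h)) (not_le.2 j.castSucc_lt_succ)
  refine ⟨j, fun v => ?_⟩
  rw [piecewise, Finset.sum_eq_single j]
  · exact indicator_of_mem (show t ∈ cell τ j from ⟨hi1, hj⟩) _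
  · intro j' _ hne
    refine indicator_of_notMem (fun h => ?_) _
    have h1 : j'.castSucc ≤ j.castSucc := hi2 _ h.1
    have h2 : j' < j := lt_of_le_of_ne (Fin.castSucc_le_castSucc_iff.1 h1) hne
    exact absurd (h.2.trans_le ((hτ (Fin.succ_le_castSucc_iff.2 h2)).trans hi1)) (lt_irrefl _)
  · exact fun h => absurd (Finset.mem_univ j) h

theorem memLp_piecewise {p : ℝ≥0∞} {μ : Measure ℝ} {v : Fin N → ℝ → E m}
    (hv : ∀ j, MemLp (v j) p μ) (τ : Fin (N + 1) → EReal) : MemLp (piecewise v τ) p μ :=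
  memLp_finsetSum _ fun j _ => (hv j).indicator (measurableSet_cell τ j)

/-- A piecewise combination of controls is a control. -/
theorem exists_control_eq_piecewise {p : ℝ≥0∞} {U : Set (E m)} (v : Fin N → Control m p U)
    {τ : Fin (N + 1) → EReal} (hτ : Monotone τ) (h0 : τ 0 = 0) (hN : τ (Fin.last N) = ⊤) :
    ∃ u : Control m p U, ∀ᵐ t ∂halfLine, u t = piecewise (fun j => v j) τ t := by
  have hm : MemLp (piecewise (fun j => v j) τ) p halfLine :=
    memLp_piecewise (fun j => Lp.memLp (v j).toLp) τ
  refine ⟨⟨hm.toLp, ?_⟩, hm.coeFn_toLp⟩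
  filter_upwards [hm.coeFn_toLp, ae_all_iff.2 fun j => (v j).mem_ae,
    ae_restrict_mem measurableSet_Ioi] with t h1 h2 h3
  obtain ⟨j, hj⟩ := exists_piecewise_eq (m := m) hτ (t := t)
    (by rw [h0]; exact_mod_cast (mem_Ioi.1 h3).le) (by rw [hN]; exact EReal.coe_lt_top t)
  rw [h1, hj]
  exact h2 j

/-- Away from the two limit endpoints the inequalities defining the limit cell are strict or
strictly violated, hence stable. -/
theorem ae_eventually_mem_cell_iff {τ : ℕ → Fin (N + 1) → EReal} {τ₀ : Fin (N + 1) → EReal}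
    (hτ : ∀ j, Tendsto (fun k => τ k j) atTop (𝓝 (τ₀ j))) (j : Fin N) :
    ∀ᵐ t : ℝ, ∀ᶠ k in atTop, (t ∈ cell (τ k) j ↔ t ∈ cell τ₀ j) := by
  have hne : ∀ c : EReal, ∀ᵐ t : ℝ, (t : EReal) ≠ c := fun c => by
    have hs : {t : ℝ | (t : EReal) = c}.Subsingleton := fun s hs t ht =>
      EReal.coe_injective (hs.trans ht.symm)
    simpa [ae_iff] using hs.measure_zero volume
  filter_upwards [hne (τ₀ j.castSucc), hne (τ₀ j.succ)] with t h1 h2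
  rcases lt_or_gt_of_ne h1 with h1 | h1
  · filter_upwards [(hτ j.castSucc).eventually (lt_mem_nhds h1)] with k hk
    exact iff_of_false (fun h => absurd h.1 (not_le.2 hk)) (fun h => absurd h.1 (not_le.2 h1))
  · rcases lt_or_gt_of_ne h2 with h2 | h2
    · filter_upwards [(hτ j.castSucc).eventually (gt_mem_nhds h1),
        (hτ j.succ).eventually (lt_mem_nhds h2)] with k hk hk'
      exact iff_of_true ⟨hk.le, hk'⟩ ⟨h1.le, h2⟩
    · filter_upwards [(hτ j.succ).eventually (gt_mem_nhds h2)] with k hk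
      exact iff_of_false (fun h => absurd h.2 (not_lt.2 hk.le))
        (fun h => absurd h.2 (not_lt.2 h2.le))

/-- Controls that are piecewise combinations of weak-star convergent controls on growing intervals
converge weakly on bounded intervals. -/
theorem tendsto_integral_of_piecewise {p : ℝ≥0∞} (hp : 1 < p) {U : Set (E m)}
    {u : ℕ → Control m p U} {u₀ : Control m p U} {T : ℕ → ℝ} (hT : Tendsto T atTop atTop)
    {v : ℕ → Fin N → Control m p U} {τ : ℕ → Fin (N + 1) → EReal}
    {v₀ : Fin N → Control m p U} {τ₀ : Fin (N + 1) → EReal}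
    (hu : ∀ k, ∀ᵐ t ∂halfLine, t ≤ T k → u k t = piecewise (fun j => v k j) (τ k) t)
    (hu₀ : ∀ᵐ t ∂halfLine, u₀ t = piecewise (fun j => v₀ j) τ₀ t)
    (hτ : ∀ j, Tendsto (fun k => τ k j) atTop (𝓝 (τ₀ j)))
    (hv : ∀ j, Tendsto (fun k => v k j) atTop (𝓝 (v₀ j)))
    (R : ℝ) {g : ℝ → E m} (hg : MemLp g p.conjExponent halfLine) :
    Tendsto (fun k => ∫ t in Ioc 0 R, inner ℝ (g t) (u k t)) atTop
      (𝓝 (∫ t in Ioc 0 R, inner ℝ (g t) (u₀ t))) := by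
  have : Fact (1 ≤ p) := ⟨hp.le⟩
  have hpp : p.conjExponent.HolderConjugate p := inferInstance
  have hp' : p.conjExponent ≠ ∞ := by
    rw [ENNReal.conjExponent]
    exact ENNReal.add_ne_top.2 ⟨ENNReal.one_ne_top, ENNReal.inv_ne_top.2 (tsub_pos_of_lt hp).ne'⟩
  -- The indicator of the cell is moved from the control to the test function, leaving the weak-star
  -- convergent piece paired with a strongly convergent factor.
  let S : (Fin (N + 1) → EReal) → Fin N → Set ℝ := fun σ j => Ioc 0 R ∩ cell σ j
  have hSm : ∀ σ j, MeasurableSet (S σ j) := fun σ j =>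
    measurableSet_Ioc.inter (measurableSet_cell σ j)
  have hgS : ∀ σ j, MemLp ((S σ j).indicator g) p.conjExponent halfLine := fun σ j =>
    hg.indicator (hSm σ j)
  have hsplit : ∀ (w : ℝ → E m) (σ : Fin (N + 1) → EReal) (ω : Fin N → Control m p U),
      (∀ᵐ t ∂halfLine, t ≤ R → w t = piecewise (fun j => ω j) σ t) →
      ∫ t in Ioc 0 R, inner ℝ (g t) (w t) =
        ∑ j, ∫ t, inner ℝ ((S σ j).indicator g t) (ω j t) ∂halfLine := by
    intro w σ ω hw
    have hint : ∀ j, Integrable (fun t => inner ℝ ((S σ j).indicator g t) (ω j t)) halfLine :=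
      fun j => memLp_one_iff_integrable.1 <|
        MemLp.of_bilin (fun x y => inner ℝ x y) 1 (hgS σ j) (Lp.memLp (ω j).toLp)
          ((hgS σ j).1.inner (Lp.memLp (ω j).toLp).1)
          (ae_of_all _ fun t => by simpa using nnnorm_inner_le_nnnorm _ _)
    rw [← integral_finsetSum _ fun j _ => hint j, ← integral_indicator measurableSet_Ioc]
    have hvol : ∫ t, (Ioc 0 R).indicator (fun t => inner ℝ (g t) (w t)) t =
        ∫ t, (Ioc 0 R).indicator (fun t => inner ℝ (g t) (w t)) t ∂halfLine := by
      rw [integral_indicator measurableSet_Ioc, integral_indicator measurableSet_Ioc, halfLine,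
        Measure.restrict_restrict measurableSet_Ioc, inter_eq_left.2 Ioc_subset_Ioi_self]
    rw [hvol]
    refine integral_congr_ae ?_
    filter_upwards [hw] with t ht
    by_cases htR : t ∈ Ioc 0 R
    · rw [indicator_of_mem htR, ht htR.2, piecewise, inner_sum]
      refine Finset.sum_congr rfl fun j _ => ?_
      change inner ℝ (g t) ((cell σ j).indicator (ω j) t) = _
      by_cases hc : t ∈ cell σ j
      · rw [indicator_of_mem hc, indicator_of_mem (show t ∈ S σ j from ⟨htR, hc⟩)]
      · rw [indicator_of_notMem hc, indicator_of_notMem (fun h : t ∈ S σ j => hc h.2),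
          inner_zero_right, inner_zero_left]
    · rw [indicator_of_notMem htR]
      refine (Finset.sum_eq_zero fun j _ => ?_).symm
      rw [indicator_of_notMem (fun h : t ∈ S σ j => htR h.1), inner_zero_left]
  rw [hsplit u₀ τ₀ v₀ (hu₀.mono fun t ht _ => ht)]
  refine Tendsto.congr' (f₁ := fun k => ∑ j, ∫ t, inner ℝ ((S (τ k) j).indicator g t)
    (v k j t) ∂halfLine) ?_ (tendsto_finsetSum _ fun j _ => ?_)
  · filter_upwards [hT.eventually_ge_atTop R] with k hk
    exact (hsplit (u k) (τ k) (v k) ((hu k).mono fun t ht h => ht (h.trans hk))).symm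
  · refine tendsto_integral_of_strong_of_weak hp.le (hv j) (fun k => hgS (τ k) j) (hgS τ₀ j) ?_
    refine tendsto_eLpNorm_zero_of_dominated (Φ := fun t => ‖g t‖ + ‖g t‖)
      (ENNReal.HolderConjugate.ne_zero p.conjExponent p) hp'
      (Eventually.of_forall fun k => (hgS (τ k) j).1.sub (hgS τ₀ j).1) (hg.norm.add hg.norm)
      (Eventually.of_forall fun k => ae_of_all _ fun t => ?_) ?_
    · exact (norm_sub_le _ _).trans (add_le_add (norm_indicator_le_norm_self _ _)
        (norm_indicator_le_norm_self _ _))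
    · have hae : halfLine ≤ volume := Measure.restrict_le_self
      filter_upwards [ae_mono hae (ae_eventually_mem_cell_iff hτ j)] with t ht
      refine tendsto_const_nhds.congr' ?_
      filter_upwards [ht] with k hk
      have : (S (τ k) j).indicator g t = (S τ₀ j).indicator g t := by
        by_cases h : t ∈ S τ₀ j
        · rw [indicator_of_mem h, indicator_of_mem (show t ∈ S (τ k) j from ⟨h.1, hk.2 h.2⟩)]
        · rw [indicator_of_notMem h,
            indicator_of_notMem (fun h' : t ∈ S (τ k) j => h ⟨h'.1, hk.1 h'.2⟩)]
      rw [Pi.sub_apply, this, sub_self]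

end Piecewise

/-! ### Measurability and growth of the running cost -/

section Integrands

/-- Superposition of a normal integrand and a measurable function is measurable. -/
theorem IsNormalIntegrand.aemeasurable {X : Type*} [TopologicalSpace X] [MeasurableSpace X]
    {f : ℝ → X → ℝ≥0∞} (hf : IsNormalIntegrand f) {R : ℝ} {y : ℝ → X}
    (hy : AEMeasurable y (volume.restrict (Ioc 0 R))) :
    AEMeasurable (fun t => f t (y t)) (volume.restrict (Ioc 0 R)) := by
  obtain ⟨y', hy', hyy'⟩ := hy
  -- The integrand is measurable only for Lebesgue sets in time, so the composition is formed over
  -- the completed σ-algebra and yields null measurability.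
  have h1 : Measurable (fun t : NullMeasurableSpace ℝ volume => y' t) :=
    (hy'.nullMeasurable (μ := volume)).measurable'
  have h2 : Measurable (fun t : NullMeasurableSpace ℝ volume =>
      (Ioi (0 : ℝ)).indicator (fun s => f s (y' t)) t) :=
    hf.meas.comp (measurable_id.prodMk h1)
  have h3 : NullMeasurable (fun t : ℝ => (Ioi (0 : ℝ)).indicator (fun s => f s (y' t)) t) volume :=
    h2
  refine h3.aemeasurable.restrict.congr ?_
  filter_upwards [hyy', ae_restrict_mem measurableSet_Ioc] with t h4 h5
  rw [indicator_of_mem (mem_Ioi.2 h5.1), h4]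

variable {n m : ℕ}

/-- Moving `γ` to the other side avoids truncated subtraction; only its positive part survives,
which weakens the bound harmlessly. -/
theorem ofReal_mul_enorm_rpow_le {p : ℝ≥0∞} {α γ : ℝ} (hα : 0 < α) {v : E m} {l : ℝ≥0∞}
    (h : ((α * ‖v‖ ^ p.toReal - γ : ℝ) : EReal) ≤ (l : EReal)) :
    ENNReal.ofReal α * ‖v‖ₑ ^ p.toReal ≤ l + ENNReal.ofReal γ := by
  rcases eq_or_ne l ∞ with rfl | hl
  · simp
  rw [← ofReal_norm, ENNReal.ofReal_rpow_of_nonneg (norm_nonneg v) ENNReal.toReal_nonneg,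
    ← ENNReal.ofReal_mul hα.le, ← ENNReal.ofReal_toReal hl]
  refine le_trans (ENNReal.ofReal_le_ofReal ?_) ENNReal.ofReal_add_le
  lift l to ℝ≥0 using hl
  have h1 : α * ‖v‖ ^ p.toReal - γ ≤ (l : ℝ) := by
    rw [EReal.coe_nnreal_eq_coe_real] at h
    exact EReal.coe_le_coe_iff.1 h
  rw [ENNReal.coe_toReal]
  linarith

theorem uniformlySuperlinear_of_coercive {p : ℝ≥0∞} (hp : 1 < p) (hp' : p ≠ ∞)
    {f : E n → E m → ℝ≥0∞} {α γ : ℝ} (hα : 0 < α)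
    (h : ∀ x v, ENNReal.ofReal α * ‖v‖ₑ ^ p.toReal ≤ f x v + ENNReal.ofReal γ) (U : Set (E m)) :
    UniformlySuperlinear f U := by
  intro c
  have hp1 : 0 < p.toReal - 1 := by
    have := (ENNReal.toReal_lt_toReal ENNReal.one_ne_top hp').2 hp
    rw [ENNReal.toReal_one] at this
    linarith
  -- For `‖v‖ ≥ 1`, `|c|(1 + ‖v‖) + |γ|` is at most `(2|c| + |γ|)‖v‖`, which the power `p > 1`
  -- eventually exceeds; the `+ 1` makes the contradiction strict.
  obtain ⟨s₀, hs₀⟩ := eventually_atTop.1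
    ((tendsto_rpow_atTop hp1).eventually_ge_atTop ((2 * |c| + |γ| + 1) / α))
  refine ⟨max s₀ 1, fun x v _ r hr hf => ?_⟩
  by_contra! hv
  have hs1 : 1 < ‖v‖ := (le_max_right _ _).trans_lt hv
  have h1 := hs₀ ‖v‖ ((le_max_left _ _).trans hv.le)
  rw [div_le_iff₀ hα] at h1
  have h2 : ‖v‖ ^ p.toReal = ‖v‖ ^ (p.toReal - 1) * ‖v‖ := by
    rw [← Real.rpow_add_one (by linarith), sub_add_cancel]
  have h3 : α * ‖v‖ ^ p.toReal ≤ |c| * (1 + ‖v‖) + |γ| := by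
    have h4 := (h x v).trans (add_le_add_left hf _)
    rw [← ofReal_norm, ENNReal.ofReal_rpow_of_nonneg (norm_nonneg v) ENNReal.toReal_nonneg,
      ← ENNReal.ofReal_mul hα.le] at h4
    have h5 : ENNReal.ofReal r + ENNReal.ofReal γ ≤
        ENNReal.ofReal (|c| * (1 + ‖v‖) + |γ|) := by
      rw [ENNReal.ofReal_add (by positivity) (by positivity)]
      refine add_le_add (ENNReal.ofReal_le_ofReal (hr.trans ?_))
        (ENNReal.ofReal_le_ofReal (le_abs_self γ))
      gcongr
      exact le_abs_self c
    exact (ENNReal.ofReal_le_ofReal_iff (by positivity)).1 (h4.trans h5)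
  rw [h2, ← mul_assoc] at h3
  nlinarith [abs_nonneg c, abs_nonneg γ, mul_le_mul_of_nonneg_right h1 (norm_nonneg v)]

theorem uniformlySuperlinear_of_isBounded {f : E n → E m → ℝ≥0∞} {U : Set (E m)}
    (hU : Bornology.IsBounded U) : UniformlySuperlinear f U := by
  obtain ⟨ρ, hρ⟩ := isBounded_iff_forall_norm_le.1 hU
  exact fun _ => ⟨ρ, fun _ v hv _ _ _ => hρ v hv⟩

end Integrands

/-! ### A priori bounds from the cost -/

section Costs

variable {n m : ℕ} {p : ℝ≥0∞} {U : Set (E m)} {a : ℝ → E n → E n} {b : ℝ → E n → E m →L[ℝ] E n}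
  {uStar : E m} {ℓ : ℝ → E n → E m → ℝ≥0∞} {x₀ : E n}

theorem cost_coe (T : ℝ) (z : Control m p U × State n) :
    cost ℓ T z = ∫⁻ t in Ioo 0 T, ℓ t (z.2 t) (z.1 t) := by
  simp only [cost, EReal.coe_lt_coe_iff]
  rfl

theorem cost_top (z : Control m p U × State n) :
    cost ℓ ⊤ z = ∫⁻ t in Ioi 0, ℓ t (z.2 t) (z.1 t) := by
  simp only [cost, EReal.coe_lt_top, and_true]
  rfl

theorem jointFunctional_of_mem {T : EReal} {z : Control m p U × State n}
    (h : z ∈ admissible a b uStar x₀ T) :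
    jointFunctional a b uStar ℓ x₀ T z = (cost ℓ T z : EReal) := by
  rw [jointFunctional, if_pos h, add_zero]

theorem jointFunctional_of_notMem {T : EReal} {z : Control m p U × State n}
    (h : z ∉ admissible a b uStar x₀ T) : jointFunctional a b uStar ℓ x₀ T z = ⊤ := by
  rw [jointFunctional, if_neg h, EReal.add_top_of_ne_bot]
  exact (EReal.bot_lt_coe_ennreal _).ne'

theorem jointFunctional_nonneg (T : EReal) (z : Control m p U × State n) :
    0 ≤ jointFunctional a b uStar ℓ x₀ T z := by
  by_cases h : z ∈ admissible a b uStar x₀ T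
  · rw [jointFunctional_of_mem h]
    exact EReal.coe_ennreal_nonneg _
  · rw [jointFunctional_of_notMem h]
    exact le_top

theorem mem_admissible_coe {T : ℝ} {z : Control m p U × State n} :
    z ∈ admissible a b uStar x₀ (T : EReal) ↔ z ∈ admissibleFin a b uStar x₀ T := by
  simp [admissible]

theorem mem_admissible_top {z : Control m p U × State n} :
    z ∈ admissible a b uStar x₀ ⊤ ↔ z ∈ admissibleInf a b x₀ := by
  simp [admissible]

theorem IsSolutionOn.mono {u : ℝ → E m} {x : ℝ → E n} {s t : ℝ} (h : IsSolutionOn a b u x₀ t x)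
    (hs : 0 ≤ s) (hst : s ≤ t) : IsSolutionOn a b u x₀ s x :=
  ⟨h.1, h.2.1.mono (uIcc_subset_uIcc left_mem_uIcc (mem_uIcc_of_le hs hst)),
    ae_mono (Measure.restrict_mono (Ioo_subset_Ioo_right hst) le_rfl) h.2.2⟩

/-- Trajectories with bounded cost are bounded. -/
theorem exists_state_bound {S : E n → ℝ} (hS : IsStorageFunction p U a b ℓ S) (hc : IsCoercive S)
    {c : ℝ≥0∞} (hct : c ≠ ∞) : ∃ ρ : ℝ, ∀ (T : ℝ) (z : Control m p U × State n),
      IsSolutionOn a b z.1 x₀ T z.2 → cost ℓ T z ≤ c → ∀ t ∈ Icc 0 T, ‖z.2 t‖ ≤ ρ := by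
  obtain ⟨ρ, hρ⟩ := isBounded_iff_forall_norm_le.1 (hc (S x₀ + c.toReal))
  refine ⟨ρ, fun T z hz hcost t ht => hρ _ ?_⟩
  -- Dissipation up to time `t`, with cost nonnegative afterwards, gives `S(x(t)) ≤ S(x₀) + c`, a
  -- bounded sublevel set.
  have h1 := hS.2 z.1 x₀ t z.2 ht.1 (hz.mono ht.1 ht.2)
  have h2 : ∫⁻ s in Ioo 0 t, ℓ s (z.2 s) (z.1 s) ≤ c := by
    rw [cost_coe] at hcost
    exact (lintegral_mono_set (Ioo_subset_Ioo_right ht.2)).trans hcost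
  have h3 := h1.trans (EReal.coe_ennreal_le_coe_ennreal_iff.2 h2)
  lift c to ℝ≥0 using hct
  have h4 : S (z.2 t) - S x₀ ≤ c := by
    rw [EReal.coe_nnreal_eq_coe_real] at h3
    exact EReal.coe_le_coe_iff.1 h3
  simp only [mem_ofPred_eq, ENNReal.coe_toReal]
  linarith

/-- Controls with bounded cost are bounded in `L^p`. -/
theorem exists_control_bound_of_coercive (hp : 1 < p) (hp' : p ≠ ∞) {α : ℝ} (hα : 0 < α)
    {γ : ℝ → ℝ} (hγ : Integrable γ halfLine)
    (h : ∀ᵐ t ∂halfLine, ∀ x v,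
      ENNReal.ofReal α * ‖v‖ₑ ^ p.toReal ≤ ℓ t x v + ENNReal.ofReal (γ t))
    {c : ℝ≥0∞} (hc : c ≠ ∞) : ∃ C : ℝ≥0∞, C ≠ ∞ ∧ ∀ (T : ℝ) (z : Control m p U × State n),
      cost ℓ T z ≤ c → eLpNorm z.1 p (volume.restrict (Ioc 0 T)) ≤ C := by
  have hp0 : p ≠ 0 := (zero_lt_one.trans hp).ne'
  have hγ' : ∫⁻ t, ENNReal.ofReal (γ t) ∂halfLine ≠ ∞ :=
    ((lintegral_ofReal_le_lintegral_enorm γ).trans_lt hγ.2).ne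
  have hα' : ENNReal.ofReal α ≠ 0 := (ENNReal.ofReal_pos.2 hα).ne'
  refine ⟨((c + ∫⁻ t, ENNReal.ofReal (γ t) ∂halfLine) / ENNReal.ofReal α) ^ (1 / p.toReal),
    ENNReal.rpow_ne_top_of_nonneg (by positivity)
      (ENNReal.div_ne_top (ENNReal.add_ne_top.2 ⟨hc, hγ'⟩) hα'), fun T z hz => ?_⟩
  rw [eLpNorm_eq_lintegral_rpow_enorm_toReal hp0 hp']
  gcongr
  rw [ENNReal.le_div_iff_mul_le (Or.inl hα') (Or.inl ENNReal.ofReal_ne_top), mul_comm,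
    ← lintegral_const_mul' _ _ ENNReal.ofReal_ne_top]
  have hle := restrict_Ioc_le_halfLine T
  calc _ ≤ ∫⁻ t in Ioc 0 T, (ℓ t (z.2 t) (z.1 t) + ENNReal.ofReal (γ t)) := by
        refine lintegral_mono_ae ?_
        filter_upwards [ae_restrict_Ioc_of_ae_halfLine h le_rfl T] with t ht using ht _ _
    _ = (∫⁻ t in Ioc 0 T, ℓ t (z.2 t) (z.1 t)) + ∫⁻ t in Ioc 0 T, ENNReal.ofReal (γ t) :=
        lintegral_add_right' _ (hγ.1.aemeasurable.mono_measure hle).ennreal_ofReal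
    _ ≤ c + ∫⁻ t, ENNReal.ofReal (γ t) ∂halfLine := by
        refine add_le_add ?_ (lintegral_mono' hle le_rfl)
        rwa [cost_coe, setLIntegral_congr Ioo_ae_eq_Ioc] at hz

theorem exists_control_bound_of_isBounded (hU : Bornology.IsBounded U) :
    ∃ C : ℝ≥0∞, C ≠ ∞ ∧ ∀ (T : ℝ) (u : Control m ∞ U),
      eLpNorm u ∞ (volume.restrict (Ioc 0 T)) ≤ C := by
  obtain ⟨ρ, hρ⟩ := isBounded_iff_forall_norm_le.1 hU
  refine ⟨ENNReal.ofReal ρ, ENNReal.ofReal_ne_top, fun T u => ?_⟩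
  rw [eLpNorm_exponent_top]
  refine eLpNormEssSup_le_of_ae_bound ?_
  filter_upwards [ae_restrict_Ioc_of_ae_halfLine u.mem_ae le_rfl T] with t ht using hρ _ ht

end Costs

variable {n m : ℕ} {p : ℝ≥0∞} {U : Set (E m)} {a : ℝ → E n → E n} {b : ℝ → E n → E m →L[ℝ] E n}
  {uStar : E m} {ℓ : ℝ → E n → E m → ℝ≥0∞} {x₀ : E n}

/-! ### Truncation of infinite-horizon competitors -/

section Truncation

/-- A solution stopped at time `T` is absolutely continuous. -/
theorem RegularSystem.absolutelyContinuousOnInterval_stopped {p' : ℝ≥0∞} [p'.HolderConjugate p]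
    (hab : RegularSystem a b p') {u : ℝ → E m} {x : ℝ → E n} (hu : MemLp u p halfLine)
    (hx : ∀ R, 0 ≤ R → IsSolutionOn a b u x₀ R x) {T : ℝ} (hT : 0 ≤ T) {R : ℝ} (hR : 0 ≤ R) :
    AbsolutelyContinuousOnInterval (fun t => x (min t T)) 0 R := by
  set τ := max R T
  have hτ : 0 ≤ τ := hR.trans (le_max_left _ _)
  obtain ⟨ρ, hρ⟩ := (hx τ hτ).2.1.exists_bound
  rw [uIcc_of_le hτ] at hρ
  obtain ⟨-, hi, heq⟩ := hab.integral_equation (p := p) hτ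
    (hu.mono_measure (restrict_Ioc_le_halfLine τ)) (hx τ hτ) hρ
  set f : ℝ → E n := fun t => a t (x t) + b t (x t) (u t)
  -- The stopped trajectory is the primitive of the velocity switched off after `T`.
  have hi' : IntervalIntegrable ((Iic T).indicator f) volume 0 R := by
    rw [intervalIntegrable_iff_integrableOn_Ioc_of_le hR]
    rw [intervalIntegrable_iff_integrableOn_Ioc_of_le hτ] at hi
    exact (hi.mono_set (Ioc_subset_Ioc_right (le_max_left _ _))).indicator measurableSet_Iic
  have hconst : AbsolutelyContinuousOnInterval (fun _ : ℝ => x₀) 0 R :=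
    (LipschitzWith.const x₀).lipschitzOnWith.absolutelyContinuousOnInterval
  refine absolutelyContinuousOnInterval_congr
    (hconst.add (absolutelyContinuousOnInterval_primitive hi')) fun t ht => ?_
  rw [uIcc_of_le hR] at ht
  have hmin : 0 ≤ min t T := le_min ht.1 hT
  simp only [Pi.add_apply]
  rw [heq (min t T) ⟨hmin, (min_le_right _ _).trans (le_max_right _ _)⟩,
    intervalIntegral.integral_of_le ht.1, intervalIntegral.integral_of_le hmin,
    setIntegral_indicator measurableSet_Iic, Ioc_inter_Iic]

/-- This is the decay factor of the truncated state, equal to 1 up to `T`. Times the stopped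
trajectory it gives both branches in one product of absolutely continuous functions. -/
theorem lipschitzWith_exp_neg_excess (T : ℝ) :
    LipschitzWith 1 fun t : ℝ => Real.exp (-(max t T - T)) := by
  refine LipschitzWith.of_dist_le_mul fun s t => ?_
  wlog hst : s ≤ t generalizing s t
  · rw [dist_comm, dist_comm s t]
    exact this t s (le_of_not_ge hst)
  have h1 : max s T ≤ max t T := max_le_max_right T hst
  have h2 : max t T - max s T ≤ t - s := by
    rcases le_total s T with h | h <;> rcases le_total t T with h' | h' <;>
      simp only [max_eq_left, max_eq_right, h, h'] <;> linarith
  have h3 : Real.exp (-(max t T - T)) =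
      Real.exp (-(max s T - T)) * Real.exp (-(max t T - max s T)) := by
    rw [← Real.exp_add]; ring_nf
  have h4 : Real.exp (-(max s T - T)) ≤ 1 :=
    Real.exp_le_one_iff.2 (by linarith [le_max_right s T])
  have h5 := Real.add_one_le_exp (-(max t T - max s T))
  have h6 : Real.exp (-(max t T - max s T)) ≤ 1 := Real.exp_le_one_iff.2 (by linarith)
  have h7 := Real.exp_pos (-(max s T - T))
  rw [NNReal.coe_one, one_mul, dist_comm s t, Real.dist_eq, Real.dist_eq,
    abs_of_nonneg (sub_nonneg.2 hst), h3, abs_of_nonneg (by nlinarith)]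
  nlinarith

/-- Truncating an admissible pair for the infinite horizon at time `T` gives an admissible pair for
the horizon `T`, at no larger cost. -/
theorem exists_truncation {p' : ℝ≥0∞} [p'.HolderConjugate p] (hab : RegularSystem a b p')
    (hU : uStar ∈ U) (hu : p ≠ ∞ → uStar = 0) {T : ℝ} (hT : 0 ≤ T) (z : Control m p U × State n) :
    ∃ w : Control m p U × State n, jointFunctional a b uStar ℓ x₀ (T : EReal) w ≤
      jointFunctional a b uStar ℓ x₀ ⊤ z := by
  by_cases hz : z ∈ admissible a b uStar x₀ ⊤
  swap
  · exact ⟨z, by rw [jointFunctional_of_notMem hz]; exact le_top⟩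
  have hz' : ∀ R, 0 ≤ R → IsSolutionOn a b z.1 x₀ R z.2 := mem_admissible_top.1 hz
  have hstar : MemLp (fun _ : ℝ => uStar) p halfLine := by
    by_cases hp : p = ∞
    · rw [hp]; exact memLp_top_const uStar
    · simp [hu hp]
  -- The infinite tail `uStar` is in L^p: it is zero for finite `p`, and a constant is bounded for
  -- `p = ∞`.
  let u : ℝ → E m := (Iic T).indicator z.1 + (Iic T)ᶜ.indicator fun _ => uStar
  have hum : MemLp u p halfLine :=
    ((Lp.memLp z.1.toLp).indicator measurableSet_Iic).add (hstar.indicator measurableSet_Iic.compl)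
  have hule : ∀ t ≤ T, u t = z.1 t := fun t ht => by
    simp [u, ht]
  have hugt : ∀ t, T < t → u t = uStar := fun t ht => by
    simp [u, ht]
  let v : Control m p U := ⟨hum.toLp, by
    filter_upwards [hum.coeFn_toLp, z.1.mem_ae] with t h1 h2
    rw [h1]
    rcases le_or_gt t T with h | h
    · rw [hule t h]; exact h2
    · rw [hugt t h]; exact hU⟩
  have hv : ∀ᵐ t ∂halfLine, v t = u t := hum.coeFn_toLp
  let x : ℝ → E n := fun t => Real.exp (-(max t T - T)) • z.2 (min t T)
  have hxle : ∀ t ≤ T, x t = z.2 t := fun t ht => by simp [x, ht]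
  let y : State n := ⟨x, fun R hR =>
    ((lipschitzWith_exp_neg_excess T).lipschitzOnWith.absolutelyContinuousOnInterval).smul
      (hab.absolutelyContinuousOnInterval_stopped (Lp.memLp z.1.toLp) hz' hT hR)⟩
  refine ⟨(v, y), ?_⟩
  have hvT : ∀ᵐ t ∂volume.restrict (Ioo 0 T), v t = u t :=
    ae_mono (Measure.restrict_mono (fun _ h => h.1) le_rfl) hv
  have hmem : (v, y) ∈ admissible a b uStar x₀ (T : EReal) := by
    rw [mem_admissible_coe]
    refine ⟨?_, ⟨?_, y.locAC T hT, ?_⟩, fun t ht => ?_⟩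
    · filter_upwards [hv] with t ht hT
      rw [ht, hugt t hT]
    · exact (hxle 0 hT).trans (hz' T hT).1
    · filter_upwards [(hz' T hT).2.2, hvT, ae_restrict_mem measurableSet_Ioo] with t h1 h2 h3
      have h4 : y =ᶠ[𝓝 t] z.2 := by
        filter_upwards [gt_mem_nhds h3.2] with s hs using hxle s hs.le
      rw [h4.self_of_nhds, h2, hule t h3.2.le]
      exact h1.congr_of_eventuallyEq h4
    · change x t = Real.exp (-(t - T)) • x T
      simp [x, ht.le]
  rw [jointFunctional_of_mem hmem, jointFunctional_of_mem hz, EReal.coe_ennreal_le_coe_ennreal_iff,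
    cost_coe, cost_top]
  calc _ = ∫⁻ t in Ioo 0 T, ℓ t (z.2 t) (z.1 t) := by
        refine lintegral_congr_ae ?_
        filter_upwards [hvT, ae_restrict_mem measurableSet_Ioo] with t h1 h2
        have h3 : y t = z.2 t := hxle t h2.2.le
        rw [h1, hule t h2.2.le, h3]
    _ ≤ _ := lintegral_mono_set fun t ht => ht.1

end Truncation

/-! ### Lower bound in the limit and optimality -/

section LimitProblem

/-- Compactness and lower semicontinuity: along admissible pairs of bounded cost with weakly
convergent controls, the limit control has a trajectory of no larger cost. -/
theorem exists_state_jointFunctional_le {p' : ℝ≥0∞} [p'.HolderConjugate p]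
    (hab : RegularSystem a b p') (hp' : p' ≠ ∞) (hUconv : Convex ℝ U) (hUc : IsClosed U)
    {S : E n → ℝ} (hS : IsStorageFunction p U a b ℓ S) (hScoer : IsCoercive S)
    (hlsc : ∀ᵐ t ∂halfLine, LowerSemicontinuous (fun z : E n × E m => ℓ t z.1 z.2))
    (hconv : ∀ᵐ t ∂halfLine, ∀ x, ConvexOn ℝ≥0 univ (ℓ t x))
    (hsup : ∀ᵐ t ∂halfLine, UniformlySuperlinear (ℓ t) U)
    (hmeas : ∀ (R : ℝ) (x : ℝ → E n) (v : ℝ → E m),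
      AEMeasurable x (volume.restrict (Ioc 0 R)) → AEMeasurable v (volume.restrict (Ioc 0 R)) →
      AEMeasurable (fun t => ℓ t (x t) (v t)) (volume.restrict (Ioc 0 R)))
    (hctrl : ∀ c : ℝ≥0∞, c ≠ ∞ → ∃ C : ℝ≥0∞, C ≠ ∞ ∧
      ∀ (T : ℝ) (z : Control m p U × State n),
        cost ℓ T z ≤ c → eLpNorm z.1 p (volume.restrict (Ioc 0 T)) ≤ C)
    {T : ℕ → ℝ} (hT : Tendsto T atTop atTop) (hT0 : ∀ k, 0 ≤ T k)
    {z : ℕ → Control m p U × State n} {u₀ : Control m p U}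
    (hweak : ∀ R : ℝ, ∀ g : ℝ → E m, MemLp g p' halfLine → Tendsto
      (fun k => ∫ t in Ioc 0 R, inner ℝ (g t) ((z k).1 t)) atTop
      (𝓝 (∫ t in Ioc 0 R, inner ℝ (g t) (u₀ t))))
    (hadm : ∀ k, z k ∈ admissible a b uStar x₀ (T k : EReal))
    {c : ℕ → ℝ≥0∞} {L : ℝ≥0∞} (hc : Antitone c) (hc0 : c 0 ≠ ∞) (hcL : Tendsto c atTop (𝓝 L))
    (hcost : ∀ k, cost ℓ (T k) (z k) ≤ c k) :
    ∃ x : State n, jointFunctional a b uStar ℓ x₀ ⊤ (u₀, x) ≤ L := by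
  have hsol : ∀ k, IsSolutionOn a b (z k).1 x₀ (T k) (z k).2 := fun k =>
    (mem_admissible_coe.1 (hadm k)).2.1
  have hcost0 : ∀ k, cost ℓ (T k) (z k) ≤ c 0 := fun k => (hcost k).trans (hc (Nat.zero_le k))
  obtain ⟨ρ, hρ⟩ := exists_state_bound (x₀ := x₀) hS hScoer hc0
  obtain ⟨C, hC, huC⟩ := hctrl (c 0) hc0
  obtain ⟨φ, hφ, y, hy, hlim⟩ := hab.exists_limit_trajectory (p := p) hp' hT hT0 hC
    (fun k => (Lp.memLp (z k).1.toLp).1) (fun k => huC (T k) (z k) (hcost0 k))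
    (Lp.memLp u₀.toLp) hweak hsol (fun k => hρ (T k) (z k) (hsol k) (hcost0 k))
  have hp1 : 1 ≤ p := have : p.HolderConjugate p' := .symm; ENNReal.HolderTriple.le p p' 1
  let Y : State n := ⟨y, fun R hR => (hy R hR).2.1⟩
  have hmem : (u₀, Y) ∈ admissible a b uStar x₀ ⊤ := mem_admissible_top.2 hy
  refine ⟨Y, ?_⟩
  rw [jointFunctional_of_mem hmem, EReal.coe_ennreal_le_coe_ennreal_iff, cost_top]
  have hint : ∀ (R : ℝ) (v : Control m p U), Integrable v (volume.restrict (Ioc 0 R)) := fun R v =>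
    ((Lp.memLp v.toLp).mono_measure (restrict_Ioc_le_halfLine R)).integrable hp1
  have hTφ : Tendsto (fun k => T (φ k)) atTop atTop := hT.comp hφ.tendsto_atTop
  have hR : ∀ R : ℝ, ∫⁻ t in Ioc 0 R, ℓ t (y t) (u₀ t) ≤ L := by
    intro R
    -- The cost on `(0, R]` is bounded by every `c N`, using only indices past `N` whose horizon
    -- exceeds `R`; the shift by `max K N` ensures both.
    refine ge_of_tendsto' hcL fun N => ?_
    obtain ⟨K, hK⟩ := eventually_atTop.1 (hTφ.eventually_gt_atTop R)
    let ψ : ℕ → ℕ := fun k => φ (k + max K N)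
    have hψ : Tendsto ψ atTop atTop := hφ.tendsto_atTop.comp (tendsto_add_atTop_nat _)
    have hψN : ∀ k, N ≤ ψ k := fun k =>
      ((le_max_right K N).trans (Nat.le_add_left _ _)).trans (hφ.id_le _)
    have hψR : ∀ k, R < T (ψ k) := fun k =>
      hK _ ((le_max_left K N).trans (Nat.le_add_left _ _))
    refine lintegral_le_of_tendsto_of_weak_tendsto (f := ℓ) hUconv hUc
      (ae_restrict_Ioc_of_ae_halfLine hlsc le_rfl R)
      (ae_restrict_Ioc_of_ae_halfLine hconv le_rfl R)
      (ae_restrict_Ioc_of_ae_halfLine hsup le_rfl R)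
      (x := fun k => (z (ψ k)).2) (x₀ := y) ?_ (u := fun k => (z (ψ k)).1) (u₀ := u₀)
      (fun k => hint R _) (hint R _)
      (fun k => ae_restrict_Ioc_of_ae_halfLine (z (ψ k)).1.mem_ae le_rfl R) ?_ (fun k => ?_)
      (ne_top_of_le_ne_top hc0 (hc (Nat.zero_le N))) (fun k => ?_)
    · filter_upwards [ae_restrict_mem measurableSet_Ioc] with t ht
      exact (hlim t ht.1.le).comp (tendsto_add_atTop_nat _)
    · rintro g hg ⟨B, hB⟩
      have hg' : MemLp ((Ioc 0 R).indicator g) p' halfLine := by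
        rw [memLp_indicator_iff_restrict measurableSet_Ioc, halfLine,
          Measure.restrict_restrict measurableSet_Ioc, inter_eq_left.2 Ioc_subset_Ioi_self]
        exact MemLp.of_bound hg B hB
      have e : ∀ v : ℝ → E m, ∫ t in Ioc 0 R, inner ℝ ((Ioc 0 R).indicator g t) (v t) =
          ∫ t in Ioc 0 R, inner ℝ (g t) (v t) := fun v =>
        setIntegral_congr_fun measurableSet_Ioc fun t ht => by
          simp only [indicator_of_mem ht]
      have h := (hweak R _ hg').comp hψ
      simp only [Function.comp_def, e] at h
      exact h
    · have hcont := ((z (ψ k)).2.locAC (T (ψ k)) (hT0 _)).continuousOn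
      rw [uIcc_of_le (hT0 _)] at hcont
      refine hmeas R _ _ ?_ (hint R _).1.aemeasurable
      exact (hcont.mono fun t ht => ⟨ht.1.le, ht.2.trans (hψR k).le⟩).aemeasurable
        measurableSet_Ioc
    · refine le_trans ?_ ((hcost (ψ k)).trans (hc (hψN k)))
      rw [cost_coe]
      exact lintegral_mono_set fun t ht => ⟨ht.1, ht.2.trans_lt (hψR k)⟩
  have hU : Ioi (0 : ℝ) = ⋃ N : ℕ, Ioc 0 (N : ℝ) := by
    ext t
    simp only [mem_Ioi, mem_iUnion, mem_Ioc]
    exact ⟨fun h => (exists_nat_ge t).imp fun N hN => ⟨h, hN⟩, fun ⟨_, h⟩ => h.1⟩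
  rw [hU, setLIntegral_iUnion_of_directed]
  · exact iSup_le fun N => hR N
  · exact Monotone.directed_le fun i j h => Ioc_subset_Ioc_right (by exact_mod_cast h)

/-- If the weak limits of the controls of a minimizing sequence are controls, then they are
optimal. -/
theorem isOptimalControl_of_isMinimizingSeq {F : EReal → Control m p U × State n → EReal}
    {T : ℕ → ℝ} {z : ℕ → Control m p U × State n}
    (hz : IsMinimizingSeq (fun k => F (T k)) z) {u₀ : Control m p U} {x : State n}
    (hx : F ⊤ (u₀, x) ≤ liminf (fun k => F (T k) (z k)) atTop)
    (htrunc : ∀ k w, ∃ w', F (T k) w' ≤ F ⊤ w) : IsOptimalControl (F ⊤) u₀ := by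
  refine ⟨x, le_antisymm (hx.trans ?_) (iInf_le _ _)⟩
  rw [hz]
  -- A number eventually below the finite-horizon infima is below the cost of a truncation of `w`,
  -- hence below that of `w`.
  refine le_iInf fun w => liminf_le_of_le (by isBoundedDefault) fun c hc => ?_
  obtain ⟨k, hk⟩ := hc.exists
  obtain ⟨w', hw'⟩ := htrunc k w
  exact (hk.trans (iInf_le _ w')).trans hw'

end LimitProblem

end OptCtrl

theorem mainTheorem1 {n m : ℕ} (p q : ℝ≥0∞) (hp : 1 < p) (hq : 1 < q) (hqp : q < p)
    (U : Set (OptCtrl.E m)) (uStar : OptCtrl.E m)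
    (a : ℝ → OptCtrl.E n → OptCtrl.E n)
    (b : ℝ → OptCtrl.E n → OptCtrl.E m →L[ℝ] OptCtrl.E n)
    (hab : OptCtrl.CaratheodoryLipschitz a b q (OptCtrl.gapExponent p q))
    (ℓ : ℝ → OptCtrl.E n → OptCtrl.E m → ℝ≥0∞)
    (hA : ∃ S : OptCtrl.E n → ℝ,
      OptCtrl.IsStorageFunction p U a b ℓ S ∧ OptCtrl.IsCoercive S)
    (ℓ₁ : ℝ → OptCtrl.E n → ℝ≥0∞) (ℓ₂ : ℝ → OptCtrl.E n → OptCtrl.E m → ℝ≥0∞)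
    (hℓ : ∀ t, 0 < t → ∀ x u, ℓ t x u = ℓ₁ t x + ℓ₂ t x u)
    (hℓ₁ : OptCtrl.IsNormalIntegrand ℓ₁) (hℓ₂ : OptCtrl.IsNormalConvexIntegrand ℓ₂)
    (hC : ∀ K : Set (OptCtrl.E n), IsCompact K → ∃ mK : ℝ → ℝ,
      Integrable mK OptCtrl.halfLine ∧
      ∀ᵐ t ∂OptCtrl.halfLine, ∀ x ∈ K, (ℓ₂ t x uStar : EReal) ≤ (mK t : EReal))
    (hC1 : p ≠ ∞ → U = univ ∧ uStar = 0 ∧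
      ∃ α : ℝ, 0 < α ∧ ∃ γ : ℝ → ℝ, Integrable γ OptCtrl.halfLine ∧
        ∀ᵐ t ∂OptCtrl.halfLine, ∀ x u,
          ((α * ‖u‖ ^ p.toReal - γ t : ℝ) : EReal) ≤ (ℓ₂ t x u : EReal))
    (hC2 : p = ∞ → IsCompact U ∧ Convex ℝ U ∧ uStar ∈ U)
    (x₀ : OptCtrl.E n) (T : ℕ → ℝ) (hT0 : ∀ k, 0 ≤ T k) (hT : Tendsto T atTop atTop) :
    OptCtrl.PatternPreserving
      (OptCtrl.jointFunctional (p := p) (U := U) a b uStar ℓ x₀) T := by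
  intro u x hmin N _ v τ vLim τLim hτ hu hτlim hv
  have : Fact (1 ≤ p) := ⟨hp.le⟩
  have hpp : p.conjExponent.HolderConjugate p := inferInstance
  have hp' : p.conjExponent ≠ ∞ := by
    rw [ENNReal.conjExponent]
    exact ENNReal.add_ne_top.2 ⟨ENNReal.one_ne_top, ENNReal.inv_ne_top.2 (tsub_pos_of_lt hp).ne'⟩
  have hreg : OptCtrl.RegularSystem a b p.conjExponent :=
    hab.regularSystem hq.le (OptCtrl.conjExponent_le_gapExponent hp hq hqp)
  obtain ⟨S, hS, hScoer⟩ := hA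
  have hU : Convex ℝ U ∧ IsClosed U ∧ uStar ∈ U := by
    by_cases h : p = ∞
    · obtain ⟨h1, h2, h3⟩ := hC2 h
      exact ⟨h2, h1.isClosed, h3⟩
    · rw [(hC1 h).1]
      exact ⟨convex_univ, isClosed_univ, mem_univ _⟩
  -- the limit control
  have hmono : Monotone τLim := fun i j hij =>
    le_of_tendsto_of_tendsto' (hτlim i) (hτlim j) fun k => by exact_mod_cast (hτ k).1 hij
  have hτ0 : τLim 0 = 0 := by
    refine tendsto_nhds_unique (hτlim 0) ?_
    simp only [(hτ _).2.1, EReal.coe_zero, tendsto_const_nhds_iff]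
  have hτN : τLim (Fin.last N) = ⊤ := by
    refine tendsto_nhds_unique (hτlim (Fin.last N)) ?_
    simp only [(hτ _).2.2]
    exact EReal.tendsto_coe_nhds_top_iff.2 hT
  obtain ⟨uLim, huLim⟩ := OptCtrl.exists_control_eq_piecewise vLim hmono hτ0 hτN
  refine ⟨uLim, huLim, ?_⟩
  have hweak := fun R g (hg : MemLp g p.conjExponent OptCtrl.halfLine) =>
    OptCtrl.tendsto_integral_of_piecewise hp hT hu huLim hτlim hv R hg
  -- properties of the running cost
  have hpos : ∀ᵐ t ∂OptCtrl.halfLine, 0 < t := ae_restrict_mem measurableSet_Ioi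
  have hfun : ∀ t, 0 < t → ℓ t = fun x u => ℓ₁ t x + ℓ₂ t x u := fun t ht =>
    funext fun x => funext fun u => hℓ t ht x u
  have hlsc : ∀ᵐ t ∂OptCtrl.halfLine,
      LowerSemicontinuous (fun z : OptCtrl.E n × OptCtrl.E m => ℓ t z.1 z.2) := by
    filter_upwards [hpos, hℓ₁.lsc, hℓ₂.normal.lsc] with t h1 h2 h3
    rw [hfun t h1]
    exact (LowerSemicontinuous.comp h2 continuous_fst).add h3
  have hconv : ∀ᵐ t ∂OptCtrl.halfLine, ∀ x, ConvexOn ℝ≥0 univ (ℓ t x) := by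
    filter_upwards [hpos, hℓ₂.convex] with t h1 h2 x
    rw [hfun t h1]
    exact (convexOn_const (ℓ₁ t x) convex_univ).add (h2 x)
  have hcoer : p ≠ ∞ → ∃ α : ℝ, 0 < α ∧ ∃ γ : ℝ → ℝ, Integrable γ OptCtrl.halfLine ∧
      ∀ᵐ t ∂OptCtrl.halfLine, ∀ x v,
        ENNReal.ofReal α * ‖v‖ₑ ^ p.toReal ≤ ℓ t x v + ENNReal.ofReal (γ t) := by
    intro h
    obtain ⟨-, -, α, hα, γ, hγ, hαγ⟩ := hC1 h
    refine ⟨α, hα, γ, hγ, ?_⟩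
    filter_upwards [hpos, hαγ] with t h1 h2 x v
    refine (OptCtrl.ofReal_mul_enorm_rpow_le hα (h2 x v)).trans (add_le_add_left ?_ _)
    rw [hℓ t h1]
    exact le_add_self
  have hsup : ∀ᵐ t ∂OptCtrl.halfLine, OptCtrl.UniformlySuperlinear (ℓ t) U := by
    by_cases h : p = ∞
    · exact ae_of_all _ fun t => OptCtrl.uniformlySuperlinear_of_isBounded (hC2 h).1.isBounded
    · obtain ⟨α, hα, γ, -, hαγ⟩ := hcoer h
      filter_upwards [hαγ] with t ht
      exact OptCtrl.uniformlySuperlinear_of_coercive hp h hα ht U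
  have hmeas : ∀ (R : ℝ) (x : ℝ → OptCtrl.E n) (v : ℝ → OptCtrl.E m),
      AEMeasurable x (volume.restrict (Ioc 0 R)) → AEMeasurable v (volume.restrict (Ioc 0 R)) →
      AEMeasurable (fun t => ℓ t (x t) (v t)) (volume.restrict (Ioc 0 R)) := by
    intro R x v hx hv
    refine ((hℓ₁.aemeasurable hx).add (hℓ₂.normal.aemeasurable (hx.prodMk hv))).congr ?_
    filter_upwards [ae_restrict_mem measurableSet_Ioc] with t ht
    exact (hℓ t ht.1 _ _).symm
  have hctrl : ∀ c : ℝ≥0∞, c ≠ ∞ → ∃ C : ℝ≥0∞, C ≠ ∞ ∧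
      ∀ (T : ℝ) (z : OptCtrl.Control m p U × OptCtrl.State n),
        OptCtrl.cost ℓ T z ≤ c → eLpNorm z.1 p (volume.restrict (Ioc 0 T)) ≤ C := by
    intro c hc
    by_cases h : p = ∞
    · subst h
      obtain ⟨C, hC, hC'⟩ := OptCtrl.exists_control_bound_of_isBounded (hC2 rfl).1.isBounded
      exact ⟨C, hC, fun T z _ => hC' T z.1⟩
    · obtain ⟨α, hα, γ, hγ, hαγ⟩ := hcoer h
      exact OptCtrl.exists_control_bound_of_coercive hp h hα hγ hαγ hc
  -- comparison with the limit of the values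
  set F := OptCtrl.jointFunctional (p := p) (U := U) a b uStar ℓ x₀ with hF
  obtain ⟨y, hy⟩ : ∃ y : OptCtrl.State n,
      F ⊤ (uLim, y) ≤ liminf (fun k => F (T k) (u k, x k)) atTop := by
    -- If the liminf is infinite, any state serves; the truncation argument then makes every
    -- infinite-horizon value infinite.
    rcases eq_or_ne (liminf (fun k => F (T k) (u k, x k)) atTop) ⊤ with htop | htop
    · exact ⟨x 0, by rw [htop]; exact le_top⟩
    have hnn : 0 ≤ liminf (fun k => F (T k) (u k, x k)) atTop :=
      le_liminf_of_le (by isBoundedDefault)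
        (Eventually.of_forall fun k => OptCtrl.jointFunctional_nonneg _ _)
    obtain ⟨L, hL⟩ : ∃ L : ℝ≥0∞, (L : EReal) = liminf (fun k => F (T k) (u k, x k)) atTop :=
      ⟨_, EReal.coe_toENNReal hnn⟩
    rw [← hL] at htop ⊢
    have hLtop : L < ∞ := lt_top_iff_ne_top.2 fun h => htop (by rw [h]; rfl)
    -- Finite levels decreasing strictly to the liminf `L` select a subsequence with `F < c i`;
    -- finiteness of these values forces admissibility.
    obtain ⟨c, hc, hcmem, hcL⟩ := exists_seq_strictAnti_tendsto' hLtop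
    obtain ⟨φ, hφ, hφc⟩ := extraction_forall_of_frequently
      (P := fun i k => F (T k) (u k, x k) < (c i : EReal)) fun i =>
        frequently_lt_of_liminf_lt (by isBoundedDefault) (by
          rw [← hL]
          exact EReal.coe_ennreal_lt_coe_ennreal_iff.2 (hcmem i).1)
    have hadm : ∀ i, (u (φ i), x (φ i)) ∈ OptCtrl.admissible a b uStar x₀ (T (φ i) : EReal) := by
      intro i
      by_contra h
      have h1 := hφc i
      rw [hF, OptCtrl.jointFunctional_of_notMem h] at h1
      exact not_top_lt h1
    refine OptCtrl.exists_state_jointFunctional_le (T := fun i => T (φ i))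
      (z := fun i => (u (φ i), x (φ i))) hreg hp' hU.1 hU.2.1 hS hScoer hlsc hconv hsup hmeas hctrl
      (hT.comp hφ.tendsto_atTop) (fun i => hT0 _)
      (fun R g hg => (hweak R g hg).comp hφ.tendsto_atTop) hadm hc.antitone (hcmem 0).2.ne hcL
      fun i => ?_
    have h1 := (hφc i).le
    rwa [hF, OptCtrl.jointFunctional_of_mem (hadm i), EReal.coe_ennreal_le_coe_ennreal_iff] at h1
  exact OptCtrl.isOptimalControl_of_isMinimizingSeq hmin hy fun k w =>
    OptCtrl.exists_truncation hreg hU.2.2 (fun h => (hC1 h).2.1) (hT0 k) w
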